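/- **Setting.** Let $n\ge 1$, and let indices $A,B,C$ run over $1,\dots,n$ and $a,b,c$ over $1,\dots,n-1$ (repeated indices are summed). Let $M_{\rm ask}\subset\mathbb C^n$ be a $\mathbb C^*$-invariant open set on which $Z^n\neq 0$, and let $F$ be a holomorphic function on $M_{\rm ask}$, homogeneous of degree $2$, such that, with $F_{AB}=\partial^2F/\partial Z^A\partial Z^B$, the real symmetric matrix $N_{AB}=\operatorname{Im}F_{AB}$ has signature $(1,n-1)$ and $Z^AN_{AB}\bar Z^B>0$ everywhere on $M_{\rm ask}$. The projective special Kähler domain $M_{\rm sk}=\{z\in\mathbb C^{n-1}\mid (z,1)\in M_{\rm ask}\}$ carries its standard complex structure $J$ and the Kähler metric with potential $K(z)=-\ln(2Z^AN_{AB}\bar Z^B)$, where here and below $Z=(z,1)$ and $F_{AB},N_{AB}$ are evaluated at $Z$. Let $e^{\,b}=e_a^{\,b}\,dz^a$ be a smooth unitary coframe of type $(1,0)$ on $M_{\rm sk}$, that is, $\sum_b e_a^{\,b}\,\overline{e_c^{\,b}}=\partial^2K/\partial z^a\partial\bar z^c$ with $(e_a^{\,b})$ invertible, and put $(\Pi_A^{\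 b})_{A=1,\dots,n}=(e_1^{\,b},\dots,e_{n-1}^{\,b},-z^ae_a^{\,b})$. Let $G=\mathbb R^{2n+2}$, with coordinates $(\phi,\tilde\phi,a^A,b_A)$, be the solvable Lie group with multiplication $$(\phi,\tilde\phi,a,b)\cdot(\phi',\tilde\phi',a',b')=\bigl(\phi+\phi',\ \tilde\phi+e^{-2\phi}\tilde\phi'+e^{-\phi}(a^Ab'_A-a'^Ab_A),\ a+e^{-\phi}a',\ b+e^{-\phi}b'\bigr).$$ The c-map manifold is $M=M_{\rm sk}\times G$, with the quaternionic vielbein $$\mathcal U=(\mathcal U^{\mathcal A m})=\tfrac1{\sqrt2}\begin{pmatrix}\bar u&\bar e&-v&-E\\ \bar v&\bar E&u&e\end{pmatrix},$$ where $$u=i e^{K/2+\phi}Z^A(db_A-F_{AB}\,da^B),\qquad v=\tfrac12e^{2\phi}\bigl[d e^{-2\phi}+i(d\tilde\phi+b_A\,da^A-a^A\,db_A)\bigr],$$ $$E^{\,b}=-\tfrac i2e^{\phi-K/2}\,\Pi_A^{\ b}N^{AB}(db_B-\bar F_{BC}\,da^C),\qquad (N^{AB})=(N_{AB})^{-1},$$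 and $J_3$ is the almost complex structure on $M$ with $\mathcal U^{1m}\circ J_3=-i\,\mathcal U^{1m}$ and $\mathcal U^{2m}\circ J_3=i\,\mathcal U^{2m}$ for all $m$ (so that $u,\bar v,e^{\,b},\bar E^{\,b}$ are its $(1,0)$-forms). **Proposition.** $J_3$ exists, is unique, and is an integrable complex structure on $M$. Moreover: (i) $J_3=J+J_G$, i.e. $J_3(\zeta,X)=(i\zeta,J_G(p)X)$ for tangent vectors $\zeta$ of $M_{\rm sk}$ at $p$ and $X$ of $G$, where $(J_G(p))_{p\in M_{\rm sk}}$ is a smooth family of left-invariant (integrable) complex structures on $G$. (ii) The projection $\pi:(M,J_3)\to M_{\rm sk}$ is a surjective holomorphic submersion, and for every $p\in M_{\rm sk}$ its fibre $(G,J_G(p))$ is biholomorphic to the domain $$F(n+1)=\Bigl\{(w^0,w_1,\dots,w_n)\in\mathbb C^{n+1}\ \Big|\ \operatorname{Re}w^0>\sum_{A=1}^{n-1}(\operatorname{Im}w_A)^2-(\operatorname{Im}w_n)^2\Bigr\}.$$ (iii) With $$w_A=b_A-F_{AB}a^B,\qquad w^0=e^{-2\phi}-i(\tilde\phi+a^Aw_A),$$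 the map $\Psi=(\pi,w^0,w_1,\dots,w_n)$ is a fibre-preserving open holomorphic embedding of $(M,J_3)$ into the trivial holomorphic bundle $M_{\rm sk}\times\mathbb C^{n+1}$, i.e. a biholomorphic map of $(M,J_3)$ onto an open subset; in particular $w^0$ and the $w_A$ are $J_3$-holomorphic. -/

import Mathlib

open scoped ContDiff ComplexConjugate

noncomputable section

/-! ### Complex structures and holomorphic maps on open subsets of real vector spaces -/

section ComplexStructures

variable {E V : Type*} [NormedAddCommGroup E] [NormedSpace ℝ E]
  [NormedAddCommGroup V] [NormedSpace ℝ V] [NormedSpace ℂ V]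

/-- `f` is a smooth map from the open set `S`, with the field of endomorphisms `J`, to the complex
vector space `V` whose differential is complex linear: `df ∘ J = i df`. -/
def IsHolomorphicOn (J : E → E →L[ℝ] E) (f : E → V) (S : Set E) : Prop :=
  ContDiffOn ℝ ∞ f S ∧
    ∀ x ∈ S, ∀ X : E, fderiv ℝ f x (J x X) = Complex.I • fderiv ℝ f x X

/-- `f` is a biholomorphic map from `(S, J)` onto the open subset `T` of the complex vector space
`V`. -/
def IsBiholomorphicOnto (J : E → E →L[ℝ] E) (f : E → V) (S : Set E) (T : Set V) : Prop :=
  IsOpen T ∧ IsHolomorphicOn J f S ∧ Set.BijOn f S T ∧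
    ∃ g : V → E, ContDiffOn ℝ ∞ g T ∧ Set.InvOn g f S T

variable (V) in
/-- `J` is an (integrable) complex structure on the open set `S`: a smooth field of endomorphisms
with `J² = -1` which admits holomorphic charts with values in `V` around every point. -/
def IsComplexStructureOn (J : E → E →L[ℝ] E) (S : Set E) : Prop :=
  ContDiffOn ℝ ∞ J S ∧ (∀ x ∈ S, ∀ X : E, J x (J x X) = -X) ∧
    ∀ x ∈ S, ∃ U : Set E, IsOpen U ∧ x ∈ U ∧ U ⊆ S ∧
      ∃ (χ : E → V) (T : Set V), IsBiholomorphicOnto J χ U T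

end ComplexStructures

/-! ### The solvable Lie group `G` -/

/-- The Lie group `G` of dimension `2n + 2`, the Iwasawa subgroup of `SU(1, n + 1)`, in its global
coordinates `(φ, φ', a, b)`, where `φ, φ' ∈ ℝ` and `a, b ∈ ℝⁿ`. As a manifold it is the coordinate
space. -/
def CMapGroup (n : ℕ) : Type := ℝ × ℝ × (Fin n → ℝ) × (Fin n → ℝ)

namespace CMapGroup

variable {n : ℕ}

instance : NormedAddCommGroup (CMapGroup n) :=
  inferInstanceAs (NormedAddCommGroup (ℝ × ℝ × (Fin n → ℝ) × (Fin n → ℝ)))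

instance : NormedSpace ℝ (CMapGroup n) :=
  inferInstanceAs (NormedSpace ℝ (ℝ × ℝ × (Fin n → ℝ) × (Fin n → ℝ)))

/-- The coordinate `φ`. -/
def phi (g : CMapGroup n) : ℝ := g.1

/-- The coordinate `φ'`, usually written as `φ` with a tilde. -/
def tphi (g : CMapGroup n) : ℝ := g.2.1

/-- The coordinates `a^A`. -/
def a (g : CMapGroup n) : Fin n → ℝ := g.2.2.1

/-- The coordinates `b_A`. -/
def b (g : CMapGroup n) : Fin n → ℝ := g.2.2.2

/-- The group multiplication of `G`. -/
instance : Mul (CMapGroup n) where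
  mul g h :=
    (g.phi + h.phi,
      g.tphi + Real.exp (-2 * g.phi) * h.tphi
        + Real.exp (-g.phi) * ∑ A, (g.a A * h.b A - h.a A * g.b A),
      fun A => g.a A + Real.exp (-g.phi) * h.a A,
      fun A => g.b A + Real.exp (-g.phi) * h.b A)

instance : One (CMapGroup n) where
  one := (0, 0, fun _ => 0, fun _ => 0)

instance : Inv (CMapGroup n) where
  inv g :=
    (-g.phi, -(Real.exp (2 * g.phi) * g.tphi),
      fun A => -(Real.exp g.phi * g.a A), fun A => -(Real.exp g.phi * g.b A))

theorem coord_ext {g h : CMapGroup n} (h1 : g.phi = h.phi) (h2 : g.tphi = h.tphi)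
    (h3 : ∀ A, g.a A = h.a A) (h4 : ∀ A, g.b A = h.b A) : g = h :=
  Prod.ext h1 (Prod.ext h2 (Prod.ext (funext h3) (funext h4)))

@[simp] theorem phi_mul (g h : CMapGroup n) : (g * h).phi = g.phi + h.phi := rfl

@[simp] theorem tphi_mul (g h : CMapGroup n) : (g * h).tphi =
    g.tphi + Real.exp (-2 * g.phi) * h.tphi
      + Real.exp (-g.phi) * ∑ A, (g.a A * h.b A - h.a A * g.b A) := rfl

@[simp] theorem a_mul (g h : CMapGroup n) (A : Fin n) :
    (g * h).a A = g.a A + Real.exp (-g.phi) * h.a A := rfl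

@[simp] theorem b_mul (g h : CMapGroup n) (A : Fin n) :
    (g * h).b A = g.b A + Real.exp (-g.phi) * h.b A := rfl

@[simp] theorem phi_one : (1 : CMapGroup n).phi = 0 := rfl
@[simp] theorem tphi_one : (1 : CMapGroup n).tphi = 0 := rfl
@[simp] theorem a_one (A : Fin n) : (1 : CMapGroup n).a A = 0 := rfl
@[simp] theorem b_one (A : Fin n) : (1 : CMapGroup n).b A = 0 := rfl

@[simp] theorem phi_inv (g : CMapGroup n) : (g⁻¹).phi = -g.phi := rfl
@[simp] theorem tphi_inv (g : CMapGroup n) :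
    (g⁻¹).tphi = -(Real.exp (2 * g.phi) * g.tphi) := rfl
@[simp] theorem a_inv (g : CMapGroup n) (A : Fin n) :
    (g⁻¹).a A = -(Real.exp g.phi * g.a A) := rfl
@[simp] theorem b_inv (g : CMapGroup n) (A : Fin n) :
    (g⁻¹).b A = -(Real.exp g.phi * g.b A) := rfl

instance : Group (CMapGroup n) where
  mul_assoc x y z := by
    have e1 : Real.exp (-(x.phi + y.phi)) = Real.exp (-x.phi) * Real.exp (-y.phi) := by
      rw [← Real.exp_add]; ring_nf
    have e2 : ∀ t : ℝ, Real.exp (-2 * t) = Real.exp (-t) * Real.exp (-t) := by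
      intro t; rw [← Real.exp_add]; ring_nf
    refine coord_ext ?_ ?_ ?_ ?_
    · simp [add_assoc]
    · have e3 : Real.exp (-2 * (x.phi + y.phi)) =
          Real.exp (-2 * x.phi) * Real.exp (-2 * y.phi) := by
        rw [← Real.exp_add]; ring_nf
      have e4 : Real.exp (-2 * x.phi) = Real.exp (-x.phi) * Real.exp (-x.phi) := e2 _
      have key : Real.exp (-x.phi) * ∑ A, (x.a A * y.b A - y.a A * x.b A)
          + Real.exp (-(x.phi + y.phi)) *
            ∑ A, ((x * y).a A * z.b A - z.a A * (x * y).b A)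
          = Real.exp (-2 * x.phi) *
              (Real.exp (-y.phi) * ∑ A, (y.a A * z.b A - z.a A * y.b A))
            + Real.exp (-x.phi) * ∑ A, (x.a A * (y * z).b A - (y * z).a A * x.b A) := by
        simp only [Finset.mul_sum, ← Finset.sum_add_distrib]
        refine Finset.sum_congr rfl fun A _ => ?_
        rw [e1, e4, a_mul, b_mul, a_mul, b_mul]
        ring
      rw [tphi_mul, tphi_mul, tphi_mul, tphi_mul, phi_mul, e3]
      linear_combination key
    · intro A; simp only [a_mul, phi_mul, e1]; ring
    · intro A; simp only [b_mul, phi_mul, e1]; ring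
  one_mul x := by refine coord_ext ?_ ?_ ?_ ?_ <;> simp
  mul_one x := by refine coord_ext ?_ ?_ ?_ ?_ <;> simp
  inv_mul_cancel x := by
    refine coord_ext ?_ ?_ ?_ ?_
    · simp
    · have h : ∑ A, ((x⁻¹).a A * x.b A - x.a A * (x⁻¹).b A) = 0 :=
        Finset.sum_eq_zero fun A _ => by rw [a_inv, b_inv]; ring
      rw [tphi_mul, h]
      simp
    · intro A; simp
    · intro A; simp

/-- A field of endomorphisms of `TG` is left-invariant if it commutes with the differentials of all
left translations `h ↦ g * h`. -/
def IsLeftInvariant (J : CMapGroup n → CMapGroup n →L[ℝ] CMapGroup n) : Prop :=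
  ∀ g h X : CMapGroup n,
    fderiv ℝ (fun h' => g * h') h (J h X) = J (g * h) (fderiv ℝ (fun h' => g * h') h X)

end CMapGroup

/-! ### Projective special Kähler domains -/

/-- The second partial derivatives `F_{AB}` of a function `F(Z^1, …, Z^n)`. -/
def prepotentialHessian {n : ℕ} (F : (Fin n → ℂ) → ℂ) (Z : Fin n → ℂ) (A B : Fin n) : ℂ :=
  fderiv ℂ (fun Z' => fderiv ℂ F Z' (Pi.single A 1)) Z (Pi.single B 1)

/-- The real symmetric matrix `N_{AB} = Im F_{AB}`. -/
def prepotentialN {n : ℕ} (F : (Fin n → ℂ) → ℂ) (Z : Fin n → ℂ) : Matrix (Fin n) (Fin n) ℝ :=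
  Matrix.of fun A B => (prepotentialHessian F Z A B).im

/-- The real number `∑ Z^A N_{AB} conj(Z^B)`. -/
def prepotentialNorm {n : ℕ} (F : (Fin n → ℂ) → ℂ) (Z : Fin n → ℂ) : ℝ :=
  (∑ A, ∑ B, Z A * (prepotentialN F Z A B : ℂ) * conj (Z B)).re

/-- A projective special Kähler domain of complex dimension `m`, presented by a holomorphic
prepotential `F`, homogeneous of degree two, on a `ℂ*`-invariant open subset `M_ask` of `ℂⁿ`,
`n = m + 1`, on which `Z^n ≠ 0`. The matrix `N = (Im F_{AB})` is required to have signature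
`(1, n - 1)` and to satisfy `∑ Z^A N_{AB} conj(Z^B) > 0`. -/
structure SpecialKahlerDomain (m : ℕ) where
  Mask : Set (Fin (m + 1) → ℂ)
  isOpen_Mask : IsOpen Mask
  smul_mem : ∀ c : ℂ, c ≠ 0 → ∀ Z ∈ Mask, c • Z ∈ Mask
  last_ne_zero : ∀ Z ∈ Mask, Z (Fin.last m) ≠ 0
  F : (Fin (m + 1) → ℂ) → ℂ
  holomorphic : DifferentiableOn ℂ F Mask
  homogeneous : ∀ c : ℂ, c ≠ 0 → ∀ Z ∈ Mask, F (c • Z) = c ^ 2 * F Z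
  norm_pos : ∀ Z ∈ Mask, 0 < prepotentialNorm F Z
  signature : ∀ Z ∈ Mask, ∃ P : Matrix (Fin (m + 1)) (Fin (m + 1)) ℝ, IsUnit P.det ∧
    P.transpose * prepotentialN F Z * P =
      Matrix.diagonal (fun A => if A = Fin.last m then 1 else -1)

/-- The Wirtinger derivative `∂f/∂z^a`. -/
def wirtinger {m : ℕ} (f : (Fin m → ℂ) → ℂ) (a : Fin m) (z : Fin m → ℂ) : ℂ :=
  (fderiv ℝ f z (Pi.single a 1) - Complex.I * fderiv ℝ f z (Pi.single a Complex.I)) / 2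

/-- The conjugate Wirtinger derivative `∂f/∂(conj z^a)`. -/
def wirtingerBar {m : ℕ} (f : (Fin m → ℂ) → ℂ) (a : Fin m) (z : Fin m → ℂ) : ℂ :=
  (fderiv ℝ f z (Pi.single a 1) + Complex.I * fderiv ℝ f z (Pi.single a Complex.I)) / 2

/-- The ambient coordinate space of `M = M_sk × G`, with coordinates `(z^a; φ, φ', a^A, b_A)`. -/
abbrev CMapSpace (m : ℕ) : Type := (Fin m → ℂ) × CMapGroup (m + 1)

/-- The index set of the `2n` columns of the quaternionic vielbein, in two groups of
`n = 1 + m`. -/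
abbrev VielbeinIndex (m : ℕ) : Type := (Unit ⊕ Fin m) ⊕ (Unit ⊕ Fin m)

/-- The Pauli matrices `σ_1, σ_2, σ_3`. -/
def pauli : Fin 3 → Matrix (Fin 2) (Fin 2) ℂ :=
  ![!![0, 1; 1, 0], !![0, -Complex.I; Complex.I, 0], !![1, 0; 0, -1]]

namespace SpecialKahlerDomain

variable {m : ℕ} (S : SpecialKahlerDomain m)

/-- The homogeneous coordinates `(Z^A) = (z^1, …, z^{n-1}, 1)`. -/
def hom (z : Fin m → ℂ) : Fin (m + 1) → ℂ := Fin.snoc z 1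

/-- The domain `M_sk ⊆ ℂ^{n-1}`, the base of the cone `M_ask`, in the coordinates
`z^a = Z^a / Z^n`. -/
def Msk : Set (Fin m → ℂ) := {z | hom z ∈ S.Mask}

/-- The manifold `M = M_sk × G`. -/
def M : Set (CMapSpace m) := S.Msk ×ˢ Set.univ

/-- `F_{AB}` at `Z = (z, 1)`. -/
def FAB (z : Fin m → ℂ) (A B : Fin (m + 1)) : ℂ := prepotentialHessian S.F (hom z) A B

/-- `N_{AB} = Im F_{AB}` at `Z = (z, 1)`. -/
def N (z : Fin m → ℂ) : Matrix (Fin (m + 1)) (Fin (m + 1)) ℝ := prepotentialN S.F (hom z)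

/-- The Kähler potential `K(z) = -log (2 ∑ Z^A N_{AB} conj(Z^B))`, `Z = (z, 1)`. -/
def K (z : Fin m → ℂ) : ℝ := -Real.log (2 * prepotentialNorm S.F (hom z))

/-- The coefficients `∂²K / ∂z^a ∂(conj z^c)` of the Kähler metric of `M_sk`. -/
def kahlerMetric (z : Fin m → ℂ) (a c : Fin m) : ℂ :=
  wirtinger (fun z' => wirtingerBar (fun z'' => (S.K z'' : ℂ)) c z') a z

/-- `e z a b` are the coefficients `e_a^b` of a smooth unitary coframe `e^b = ∑ e_a^b dz^a` of type
`(1,0)` for the Kähler metric of `M_sk`. -/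
structure IsVielbein (e : (Fin m → ℂ) → Matrix (Fin m) (Fin m) ℂ) : Prop where
  smooth : ∀ a b, ContDiffOn ℝ ∞ (fun z => e z a b) S.Msk
  coframe : ∀ z ∈ S.Msk, IsUnit (e z).det
  unitary : ∀ z ∈ S.Msk, ∀ a c, ∑ b, e z a b * conj (e z c b) = S.kahlerMetric z a c

/-- `Π_A^b = (e_a^b, -∑ z^a e_a^b)`. -/
def PiCoeff (e : (Fin m → ℂ) → Matrix (Fin m) (Fin m) ℂ) (z : Fin m → ℂ) (b : Fin m) :
    Fin (m + 1) → ℂ :=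
  Fin.snoc (fun a => e z a b) (-∑ a, z a * e z a b)

/-! The one-forms `u, v, e^b, E^b` at the point `x = (z, g)` of `M`, evaluated on a tangent vector
`X`. The differentials of the coordinates `z^a, φ, φ', a^A, b_A` evaluated on `X` are the components
`X.1 a`, `X.2.phi`, `X.2.tphi`, `X.2.a A`, `X.2.b A`. -/

/-- `u = i e^{K/2 + φ} ∑ Z^A (db_A - ∑ F_{AB} da^B)`. -/
def formU (x X : CMapSpace m) : ℂ :=
  Complex.I * (Real.exp (S.K x.1 / 2 + x.2.phi) : ℂ) *
    ∑ A, hom x.1 A * ((X.2.b A : ℂ) - ∑ B, S.FAB x.1 A B * (X.2.a B : ℂ))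

/-- `v = (1/2) e^{2φ} (d e^{-2φ} + i (dφ' + ∑ (b_A da^A - a^A db_A)))`. -/
def formV (x X : CMapSpace m) : ℂ :=
  (1 / 2) * (Real.exp (2 * x.2.phi) : ℂ) *
    (((-2 * Real.exp (-2 * x.2.phi) * X.2.phi : ℝ) : ℂ) +
      Complex.I * ((X.2.tphi + ∑ A, (x.2.b A * X.2.a A - x.2.a A * X.2.b A) : ℝ) : ℂ))

/-- `e^b = ∑ e_a^b dz^a`. -/
def forme (e : (Fin m → ℂ) → Matrix (Fin m) (Fin m) ℂ) (b : Fin m) (x X : CMapSpace m) : ℂ :=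
  ∑ a, e x.1 a b * X.1 a

/-- `E^b = -(i/2) e^{φ - K/2} ∑ Π_A^b N^{AB} (db_B - ∑ conj(F_{BC}) da^C)`. -/
def formE (e : (Fin m → ℂ) → Matrix (Fin m) (Fin m) ℂ) (b : Fin m) (x X : CMapSpace m) : ℂ :=
  -(Complex.I / 2) * (Real.exp (x.2.phi - S.K x.1 / 2) : ℂ) *
    ∑ A, ∑ B, PiCoeff e x.1 b A * (((S.N x.1)⁻¹ A B : ℝ) : ℂ) *
      ((X.2.b B : ℂ) - ∑ C, conj (S.FAB x.1 B C) * (X.2.a C : ℂ))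

/-- The quaternionic vielbein
`𝒰 = (1/√2) (ū, ē, -v, -E; v̄, Ē, u, e)`, a system of `2 × 2n` complex one-forms. -/
def vielbein (e : (Fin m → ℂ) → Matrix (Fin m) (Fin m) ℂ) (x : CMapSpace m) (i : Fin 2)
    (k : VielbeinIndex m) (X : CMapSpace m) : ℂ :=
  ((1 / Real.sqrt 2 : ℝ) : ℂ) *
    (![Sum.elim
        (Sum.elim (fun _ => conj (S.formU x X)) (fun b => conj (forme e b x X)))
        (Sum.elim (fun _ => -formV x X) (fun b => -S.formE e b x X)),
      Sum.elim
        (Sum.elim (fun _ => conj (formV x X)) (fun b => conj (S.formE e b x X)))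
        (Sum.elim (fun _ => S.formU x X) (fun b => forme e b x X))] i k)

/-- `J` is the field of endomorphisms `J_{α+1}` of `TM` (with `α ∈ {0, 1, 2}`) determined by the
quaternionic vielbein: `𝒰^{i k} ∘ J = -i ∑_j (σ_{α+1})^i_j 𝒰^{j k}`. -/
def IsCMapJ (e : (Fin m → ℂ) → Matrix (Fin m) (Fin m) ℂ) (α : Fin 3)
    (J : CMapSpace m → CMapSpace m →L[ℝ] CMapSpace m) : Prop :=
  ∀ x ∈ S.M, ∀ (i : Fin 2) (k : VielbeinIndex m) (X : CMapSpace m),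
    S.vielbein e x i k (J x X) = -Complex.I * ∑ j, pauli α i j * S.vielbein e x j k X

/-- `w_A = b_A - ∑ F_{AB} a^B`. -/
def w (x : CMapSpace m) (A : Fin (m + 1)) : ℂ :=
  (x.2.b A : ℂ) - ∑ B, S.FAB x.1 A B * (x.2.a B : ℂ)

/-- `w^0 = e^{-2φ} - i (φ' + ∑ a^A w_A)`. -/
def w0 (x : CMapSpace m) : ℂ :=
  (Real.exp (-2 * x.2.phi) : ℂ) -
    Complex.I * ((x.2.tphi : ℂ) + ∑ A, (x.2.a A : ℂ) * S.w x A)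

/-- `Ψ = (π, w^0, w_A) : M → M_sk × ℂ^{n+1}`. -/
def Psi (x : CMapSpace m) : (Fin m → ℂ) × (ℂ × (Fin (m + 1) → ℂ)) :=
  (x.1, (S.w0 x, S.w x))

end SpecialKahlerDomain

/-- The domain `F(n+1) = {(w^0, w_1, …, w_n) | Re w^0 > ∑_{A<n} (Im w_A)² - (Im w_n)²}` of `ℂ^{n+1}`,
where `n = m + 1`. -/
def fibreDomain (m : ℕ) : Set (ℂ × (Fin (m + 1) → ℂ)) :=
  {w | (∑ A : Fin m, (w.2 A.castSucc).im ^ 2) - (w.2 (Fin.last m)).im ^ 2 < w.1.re}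

end

/-! Everything is expressed in a few real-linear forms on `G`: `dφ`, `θ = dφ' + ∑ (b_A da^A - a^A
db_A)` (`theta`) and `β_A = db_A - ∑ F_{AB} da^B` (`beta`). Since `N = Im F` is invertible, `β`
identifies the `(a, b)`-directions with `ℂⁿ`, so these forms separate tangent vectors (`ext_forms`).
Requiring `β ∘ J = iβ`, and that `J` rotate the pair `(dφ, ½ e^{2φ} θ)`, therefore fixes an
endomorphism `fibreJ`. A left translation only rescales `θ` and `β`, by `e^{-2φ}` and `e^{-φ}`, so
`fibreJ` is left-invariant.

In the vielbein, `u` is a multiple of `∑ Z^A β_A`, `E^b` a combination of the `conj(β_B)`, and `v =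
-dφ + (i/2) e^{2φ} θ`. Hence `J3 = i ⊕ fibreJ` satisfies the defining relations (`isCMapJ_J3`).
Uniqueness means that the vielbein has no kernel (`ext_vielbein`). This comes down to a linear
system whose solutions are multiples of `Z` in the kernel of `Π`, and these are excluded by `∑ Z^A
N_{AB} conj(Z^B) > 0` (`eq_zero_of_forms`).

Integrability is obtained from explicit coordinates rather than from a torsion computation. The
differentials of `w_A` and `w^0` are combinations of `β_A`, `conj(v)` and the `dF_{AB}`, all of type
`(1,0)`. The map `Ψ` has an explicit smooth inverse on the open set where the expression for
`e^{-2φ}` in terms of `(z, w)` is positive (`isBiholomorphicOnto_Psi`), so it is one global chart.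
On a fibre that expression is `Re w^0 + ∑ N^{AB} Im w_A Im w_B`, and a real linear change of the
`w_A` diagonalising `N` turns its positivity domain into `F(n+1)`.

The analytic input is that a complex differentiable function of several variables is smooth, which
gives both the smoothness of `F_{AB}` and the symmetry `F_{AB} = F_{BA}`. -/

/-! ### Smoothness of holomorphic functions of several variables -/

section SeveralVariables

variable {E : Type*} [NormedAddCommGroup E] [NormedSpace ℂ E]

/-- Cauchy's formula for a directional derivative. -/
theorem cauchy_fderiv_apply {f : E → ℂ} {U : Set E} (hU : IsOpen U)
    (hf : DifferentiableOn ℂ f U) {z v : E} {ρ : ℝ} (hρ : 0 < ρ)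
    (h : ∀ t : ℂ, ‖t‖ ≤ ρ → z + t • v ∈ U) :
    (2 * (Real.pi : ℂ) * Complex.I)⁻¹ • ∮ t in C((0 : ℂ), ρ), (t ^ 2)⁻¹ • f (z + t • v)
      = fderiv ℂ f z v := by
  have hline : ∀ t : ℂ, HasDerivAt (fun t : ℂ => z + t • v) v t := fun t => by
    simpa using ((hasDerivAt_id t).smul_const v).const_add z
  have hO : IsOpen ((fun t : ℂ => z + t • v) ⁻¹' U) :=
    hU.preimage (by fun_prop)
  have hd : DifferentiableOn ℂ (fun t : ℂ => f (z + t • v)) ((fun t : ℂ => z + t • v) ⁻¹' U) :=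
    fun t ht => ((hf.differentiableAt (hU.mem_nhds ht)).comp t
      (hline t).differentiableAt).differentiableWithinAt
  -- One-variable Cauchy formula for the derivative at `0` of `t ↦ f (z + t • v)`.
  have key := Complex.two_pi_I_inv_smul_circleIntegral_sub_sq_inv_smul_of_differentiable hO
    (c := 0) (R := ρ) (w₀ := 0) (fun t ht => h t (by simpa using ht)) hd (by simpa using hρ)
  have hz : z + (0 : ℂ) • v ∈ U := h 0 (by simpa using hρ.le)
  have hf0 : HasFDerivAt f (fderiv ℂ f z) (z + (0 : ℂ) • v) := by
    have := (hf.differentiableAt (hU.mem_nhds hz)).hasFDerivAt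
    simpa using this
  have hder : deriv (fun t : ℂ => f (z + t • v)) 0 = fderiv ℂ f z v :=
    (hf0.comp_hasDerivAt (0 : ℂ) (hline 0)).deriv
  rw [hder] at key
  simpa using key

/-- Cauchy's formula expresses the directional derivative as a circle integral of `f`, which may be
differentiated in `z` under the integral sign. The domination needs only a local bound on `fderiv ℂ
f` and its measurability, so continuity of the derivative is not presupposed. -/
theorem differentiableOn_fderiv_apply [FiniteDimensional ℂ E] {f : E → ℂ} {U : Set E}
    (hU : IsOpen U) (hf : DifferentiableOn ℂ f U) (v : E) :
    DifferentiableOn ℂ (fun z => fderiv ℂ f z v) U := by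
  intro z₀ hz₀
  refine DifferentiableAt.differentiableWithinAt ?_
  borelize E
  -- On the ball of radius `3r` two values of `f` differ by less than `2`; the Cauchy estimate on
  -- balls of radius `r` centred in the ball of radius `2r` then bounds the derivative by `2 / r`.
  obtain ⟨r, hr, hball⟩ : ∃ r > 0, Metric.ball z₀ (3 * r) ⊆ U ∩ f ⁻¹' Metric.ball (f z₀) 1 := by
    have hmem : U ∩ f ⁻¹' Metric.ball (f z₀) 1 ∈ nhds z₀ := Filter.inter_mem (hU.mem_nhds hz₀)
      ((hf.differentiableAt (hU.mem_nhds hz₀)).continuousAt.preimage_mem_nhds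
        (Metric.ball_mem_nhds _ one_pos))
    obtain ⟨r, hr, h⟩ := Metric.mem_nhds_iff.1 hmem
    exact ⟨r / 3, by positivity, by convert h using 2; ring⟩
  have hbound : ∀ y ∈ Metric.ball z₀ (2 * r), ‖fderiv ℂ f y‖ ≤ 2 / r := by
    intro y hy
    have hsub : Metric.ball y r ⊆ Metric.ball z₀ (3 * r) :=
      Metric.ball_subset_ball' (by have := Metric.mem_ball.1 hy; linarith)
    refine Complex.norm_fderiv_le_div_of_mapsTo_ball
      (hf.mono fun x hx => (hball (hsub hx)).1) ?_ hr
    intro x hx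
    have h1 := Metric.mem_ball.1 (hball (hsub hx)).2
    have h2 := Metric.mem_ball.1 (hball (hsub (Metric.mem_ball_self hr))).2
    have h3 := dist_triangle_right (f x) (f y) (f z₀)
    refine Metric.mem_closedBall.2 (?_ : dist (f x) (f y) ≤ 2)
    linarith
  -- The circle radius is chosen so that `z + t • v` stays in the ball of radius `2r`; the `+ 1`
  -- covers `v = 0`.
  set ρ : ℝ := r / (‖v‖ + 1) with hρdef
  have hρ : 0 < ρ := by positivity
  have hρv : ρ * ‖v‖ < r := by
    rw [hρdef, div_mul_eq_mul_div, div_lt_iff₀ (by positivity)]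
    nlinarith [norm_nonneg v]
  have hmem : ∀ z ∈ Metric.ball z₀ r, ∀ t : ℂ, ‖t‖ ≤ ρ → z + t • v ∈ Metric.ball z₀ (2 * r) := by
    intro z hz t ht
    rw [mem_ball_iff_norm] at hz ⊢
    calc ‖z + t • v - z₀‖ = ‖(z - z₀) + t • v‖ := by congr 1; abel
      _ ≤ ‖z - z₀‖ + ‖t‖ * ‖v‖ := by rw [← norm_smul]; exact norm_add_le _ _
      _ ≤ ‖z - z₀‖ + ρ * ‖v‖ := by gcongr
      _ < 2 * r := by linarith
  have hsub : ∀ y ∈ Metric.ball z₀ (2 * r), y ∈ U := fun y hy =>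
    (hball (Metric.ball_subset_ball (by linarith) hy)).1
  have hcirc : ∀ θ : ℝ, ‖circleMap 0 ρ θ‖ ≤ ρ := fun θ => by simp [abs_of_pos hρ]
  have hcirc0 : ∀ θ : ℝ, circleMap 0 ρ θ ≠ 0 := fun θ => circleMap_ne_center hρ.ne'
  set c : ℝ → ℂ := fun θ => deriv (circleMap 0 ρ) θ * ((circleMap 0 ρ θ) ^ 2)⁻¹ with hc
  have hccont : Continuous c := by
    have : Continuous fun θ : ℝ => ((circleMap 0 ρ θ) ^ 2)⁻¹ :=
      ((continuous_circleMap 0 ρ).pow 2).inv₀ fun θ => pow_ne_zero 2 (hcirc0 θ)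
    simp only [hc, deriv_circleMap]
    exact ((continuous_circleMap 0 ρ).mul continuous_const).mul this
  have hcont : ∀ z ∈ Metric.ball z₀ r,
      Continuous fun θ : ℝ => c θ • f (z + circleMap 0 ρ θ • v) := by
    intro z hz
    refine hccont.smul (hf.continuousOn.comp_continuous ?_ ?_)
    · exact continuous_const.add ((continuous_circleMap 0 ρ).smul continuous_const)
    · exact fun θ => hsub _ (hmem z hz _ (hcirc θ))
  have hderiv := intervalIntegral.hasFDerivAt_integral_of_dominated_of_fderiv_le
    (𝕜 := ℂ) (μ := MeasureTheory.volume) (a := 0) (b := 2 * Real.pi)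
    (F := fun z θ => c θ • f (z + circleMap 0 ρ θ • v))
    (F' := fun z θ => c θ • fderiv ℂ f (z + circleMap 0 ρ θ • v))
    (bound := fun θ => ‖c θ‖ * (2 / r)) (Metric.ball_mem_nhds z₀ hr)
    (by
      filter_upwards [Metric.ball_mem_nhds z₀ hr] with z hz
      exact (hcont z hz).aestronglyMeasurable)
    ((hcont z₀ (Metric.mem_ball_self hr)).intervalIntegrable _ _)
    (by
      refine (hccont.aestronglyMeasurable).smul ?_
      refine Measurable.aestronglyMeasurable ?_
      exact (measurable_fderiv ℂ f).comp (continuous_const.add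
        ((continuous_circleMap 0 ρ).smul continuous_const)).measurable)
    (by
      refine Filter.Eventually.of_forall fun θ _ z hz => ?_
      rw [norm_smul]
      gcongr
      exact hbound _ (hmem z hz _ (hcirc θ)))
    ((hccont.norm.mul continuous_const).intervalIntegrable _ _)
    (by
      refine Filter.Eventually.of_forall fun θ _ z hz => ?_
      have h1 := (hf.differentiableAt (hU.mem_nhds (hsub _ (hmem z hz _ (hcirc θ))))).hasFDerivAt
      have h2 : HasFDerivAt (fun z : E => z + circleMap 0 ρ θ • v) (ContinuousLinearMap.id ℂ E) z :=
        (hasFDerivAt_id z).add_const _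
      exact (h1.comp z h2).const_smul (c θ))
  refine ((hderiv.differentiableAt).const_smul
    (2 * (Real.pi : ℂ) * Complex.I)⁻¹).congr_of_eventuallyEq ?_
  filter_upwards [Metric.ball_mem_nhds z₀ hr] with z hz
  rw [← cauchy_fderiv_apply hU hf hρ fun t ht => hsub _ (hmem z hz t ht)]
  simp only [circleIntegral, hc, smul_eq_mul, mul_assoc, Pi.smul_apply]

/-- A complex differentiable function of several variables is smooth. -/
theorem contDiffOn_of_differentiableOn_complex [FiniteDimensional ℂ E] {f : E → ℂ} {U : Set E}
    (hU : IsOpen U) (hf : DifferentiableOn ℂ f U) : ContDiffOn ℂ ∞ f U := by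
  rw [contDiffOn_infty]
  intro k
  induction k generalizing f with
  | zero => exact contDiffOn_zero.2 hf.continuousOn
  | succ k ih =>
    push_cast
    rw [contDiffOn_succ_iff_fderiv_of_isOpen hU]
    -- The middle condition concerns analytic order only, and the order here is finite.
    refine ⟨hf, fun h => absurd h (by simp), ?_⟩
    rw [contDiffOn_clm_apply]
    exact fun v => ih (differentiableOn_fderiv_apply hU hf v)

end SeveralVariables

/-! ### Coordinates and left translations on `G` -/

namespace CMapGroup

variable {n : ℕ}

instance : FiniteDimensional ℝ (CMapGroup n) :=
  inferInstanceAs (FiniteDimensional ℝ (ℝ × ℝ × (Fin n → ℝ) × (Fin n → ℝ)))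

/-- The element of `G` with given coordinates. -/
def mk (s t : ℝ) (x y : Fin n → ℝ) : CMapGroup n := (s, t, x, y)

@[simp] theorem phi_mk (s t : ℝ) (x y : Fin n → ℝ) : (mk s t x y).phi = s := rfl
@[simp] theorem tphi_mk (s t : ℝ) (x y : Fin n → ℝ) : (mk s t x y).tphi = t := rfl
@[simp] theorem a_mk (s t : ℝ) (x y : Fin n → ℝ) : (mk s t x y).a = x := rfl
@[simp] theorem b_mk (s t : ℝ) (x y : Fin n → ℝ) : (mk s t x y).b = y := rfl

@[simp] theorem phi_add (g h : CMapGroup n) : (g + h).phi = g.phi + h.phi := rfl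
@[simp] theorem tphi_add (g h : CMapGroup n) : (g + h).tphi = g.tphi + h.tphi := rfl
@[simp] theorem a_add (g h : CMapGroup n) : (g + h).a = g.a + h.a := rfl
@[simp] theorem b_add (g h : CMapGroup n) : (g + h).b = g.b + h.b := rfl
@[simp] theorem phi_smul (c : ℝ) (g : CMapGroup n) : (c • g).phi = c * g.phi := rfl
@[simp] theorem tphi_smul (c : ℝ) (g : CMapGroup n) : (c • g).tphi = c * g.tphi := rfl
@[simp] theorem a_smul (c : ℝ) (g : CMapGroup n) : (c • g).a = c • g.a := rfl
@[simp] theorem b_smul (c : ℝ) (g : CMapGroup n) : (c • g).b = c • g.b := rfl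
@[simp] theorem phi_neg (g : CMapGroup n) : (-g).phi = -g.phi := rfl

/-- The coordinate `φ` as a linear form. -/
noncomputable def phiL : CMapGroup n →L[ℝ] ℝ :=
  (ContinuousLinearMap.fst ℝ ℝ (ℝ × (Fin n → ℝ) × (Fin n → ℝ)) :)

/-- The second coordinate as a linear form. -/
noncomputable def tphiL : CMapGroup n →L[ℝ] ℝ :=
  ((ContinuousLinearMap.fst ℝ ℝ ((Fin n → ℝ) × (Fin n → ℝ))).comp
    (ContinuousLinearMap.snd ℝ ℝ (ℝ × (Fin n → ℝ) × (Fin n → ℝ))) :)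

/-- The coordinates `a^A` as a linear map. -/
noncomputable def aL : CMapGroup n →L[ℝ] (Fin n → ℝ) :=
  ((ContinuousLinearMap.fst ℝ (Fin n → ℝ) (Fin n → ℝ)).comp
    ((ContinuousLinearMap.snd ℝ ℝ ((Fin n → ℝ) × (Fin n → ℝ))).comp
      (ContinuousLinearMap.snd ℝ ℝ (ℝ × (Fin n → ℝ) × (Fin n → ℝ)))) :)

/-- The coordinates `b_A` as a linear map. -/
noncomputable def bL : CMapGroup n →L[ℝ] (Fin n → ℝ) :=
  ((ContinuousLinearMap.snd ℝ (Fin n → ℝ) (Fin n → ℝ)).comp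
    ((ContinuousLinearMap.snd ℝ ℝ ((Fin n → ℝ) × (Fin n → ℝ))).comp
      (ContinuousLinearMap.snd ℝ ℝ (ℝ × (Fin n → ℝ) × (Fin n → ℝ)))) :)

@[simp] theorem phiL_apply (g : CMapGroup n) : phiL g = g.phi := rfl
@[simp] theorem tphiL_apply (g : CMapGroup n) : tphiL g = g.tphi := rfl
@[simp] theorem aL_apply (g : CMapGroup n) : aL g = g.a := rfl
@[simp] theorem bL_apply (g : CMapGroup n) : bL g = g.b := rfl

theorem hasFDerivAt_phi (g : CMapGroup n) : HasFDerivAt phi (phiL (n := n)) g :=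
  phiL.hasFDerivAt

theorem hasFDerivAt_tphi (g : CMapGroup n) : HasFDerivAt tphi (tphiL (n := n)) g :=
  tphiL.hasFDerivAt

theorem hasFDerivAt_a (g : CMapGroup n) : HasFDerivAt a (aL (n := n)) g :=
  aL.hasFDerivAt

theorem hasFDerivAt_b (g : CMapGroup n) : HasFDerivAt b (bL (n := n)) g :=
  bL.hasFDerivAt

theorem contDiff_phi {k : WithTop ℕ∞} : ContDiff ℝ k (phi (n := n)) := phiL.contDiff
theorem contDiff_tphi {k : WithTop ℕ∞} : ContDiff ℝ k (tphi (n := n)) := tphiL.contDiff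
theorem contDiff_a {k : WithTop ℕ∞} (A : Fin n) :
    ContDiff ℝ k (fun g : CMapGroup n => g.a A) :=
  (contDiff_apply ℝ ℝ A).comp aL.contDiff
theorem contDiff_b {k : WithTop ℕ∞} (A : Fin n) :
    ContDiff ℝ k (fun g : CMapGroup n => g.b A) :=
  (contDiff_apply ℝ ℝ A).comp bL.contDiff

theorem contDiffOn_mk {E : Type*} [NormedAddCommGroup E] [NormedSpace ℝ E] {k : WithTop ℕ∞}
    {s : Set E} {p t : E → ℝ} {x y : E → Fin n → ℝ} (hp : ContDiffOn ℝ k p s)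
    (ht : ContDiffOn ℝ k t s) (hx : ∀ A, ContDiffOn ℝ k (fun q => x q A) s)
    (hy : ∀ A, ContDiffOn ℝ k (fun q => y q A) s) :
    ContDiffOn ℝ k (fun q => mk (p q) (t q) (x q) (y q)) s :=
  (hp.prodMk (ht.prodMk ((contDiffOn_pi.2 hx).prodMk (contDiffOn_pi.2 hy))) :)

theorem fderiv_mk_apply {E : Type*} [NormedAddCommGroup E] [NormedSpace ℝ E]
    {q : E} {p t : E → ℝ} {x y : E → Fin n → ℝ} {p' t' : E →L[ℝ] ℝ} {x' y' : E →L[ℝ] (Fin n → ℝ)}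
    (hp : HasFDerivAt p p' q) (ht : HasFDerivAt t t' q) (hx : HasFDerivAt x x' q)
    (hy : HasFDerivAt y y' q) (X : E) :
    fderiv ℝ (fun q => mk (p q) (t q) (x q) (y q)) q X = mk (p' X) (t' X) (x' X) (y' X) := by
  have := (hp.prodMk (ht.prodMk (hx.prodMk hy))).fderiv
  exact (congrArg (fun L => L X) this :)

/-- The differential of a left translation. -/
theorem fderiv_mul_left (g h X : CMapGroup n) :
    fderiv ℝ (fun h' => g * h') h X =
      mk X.phi (Real.exp (-2 * g.phi) * X.tphi
          + Real.exp (-g.phi) * ∑ A, (g.a A * X.b A - X.a A * g.b A))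
        (Real.exp (-g.phi) • X.a) (Real.exp (-g.phi) • X.b) := by
  have hA : ∀ A, HasFDerivAt (fun h' : CMapGroup n => h'.a A)
      ((ContinuousLinearMap.proj A).comp (aL (n := n))) h := fun A =>
    ((ContinuousLinearMap.proj (R := ℝ) (φ := fun _ : Fin n => ℝ) A).comp aL).hasFDerivAt
  have hB : ∀ A, HasFDerivAt (fun h' : CMapGroup n => h'.b A)
      ((ContinuousLinearMap.proj A).comp (bL (n := n))) h := fun A =>
    ((ContinuousLinearMap.proj (R := ℝ) (φ := fun _ : Fin n => ℝ) A).comp bL).hasFDerivAt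
  have key := fderiv_mk_apply ((hasFDerivAt_phi h).const_add g.phi)
    ((((hasFDerivAt_tphi h).const_mul (Real.exp (-2 * g.phi))).const_add g.tphi).add
      ((HasFDerivAt.fun_sum fun A (_ : A ∈ Finset.univ) =>
        ((hB A).const_mul (g.a A)).sub ((hA A).mul_const (g.b A))).const_mul (Real.exp (-g.phi))))
    (((hasFDerivAt_a h).const_smul (Real.exp (-g.phi))).const_add g.a)
    (((hasFDerivAt_b h).const_smul (Real.exp (-g.phi))).const_add g.b) X
  refine Eq.trans ?_ (key.trans ?_)
  · rfl
  · refine coord_ext ?_ ?_ ?_ ?_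
    · simp
    · simp [mul_comm]
    · intro A; simp
    · intro A; simp

/-- The form `θ = dφ' + ∑ (b_A da^A - a^A db_A)` at `g`; the form `e^{2φ} θ` is left-invariant. -/
noncomputable def theta (g X : CMapGroup n) : ℝ :=
  X.tphi + ∑ A, (g.b A * X.a A - g.a A * X.b A)

/-- The terms linear in the `a`- and `b`-coordinates of `g` cancel between the cocycle in the group
law and the shift of the coefficients of `θ`. -/
theorem theta_fderiv_mul_left (g h X : CMapGroup n) :
    theta (g * h) (fderiv ℝ (fun h' => g * h') h X) = Real.exp (-2 * g.phi) * theta h X := by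
  have e2 : Real.exp (-2 * g.phi) = Real.exp (-g.phi) * Real.exp (-g.phi) := by
    rw [← Real.exp_add]; ring_nf
  rw [fderiv_mul_left, theta, theta, e2]
  simp only [tphi_mk, a_mk, b_mk, a_mul, b_mul, Pi.smul_apply, smul_eq_mul, mul_add,
    Finset.mul_sum, add_assoc, ← Finset.sum_add_distrib]
  congr 1
  exact Finset.sum_congr rfl fun A _ => by ring

end CMapGroup

/-! ### The left-invariant complex structure on a fibre -/

namespace CMapGroup

variable {n : ℕ}

theorem theta_add (g X Y : CMapGroup n) : theta g (X + Y) = theta g X + theta g Y := by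
  simp only [theta, tphi_add, a_add, b_add, Pi.add_apply]
  rw [add_add_add_comm, ← Finset.sum_add_distrib]
  congr 1
  exact Finset.sum_congr rfl fun A _ => by ring

theorem theta_smul (g : CMapGroup n) (c : ℝ) (X : CMapGroup n) :
    theta g (c • X) = c * theta g X := by
  simp only [theta, tphi_smul, a_smul, b_smul, Pi.smul_apply, smul_eq_mul, mul_add,
    Finset.mul_sum]
  congr 1
  exact Finset.sum_congr rfl fun A _ => by ring

theorem theta_neg (g X : CMapGroup n) : theta g (-X) = -theta g X := by
  rw [← neg_one_smul ℝ X, theta_smul, neg_one_mul]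

/-- The complex one-forms `β_A = db_A - ∑ F_{AB} da^B`. -/
noncomputable def beta (F : Matrix (Fin n) (Fin n) ℂ) (X : CMapGroup n) (A : Fin n) : ℂ :=
  (X.b A : ℂ) - ∑ B, F A B * (X.a B : ℂ)

theorem beta_smul (F : Matrix (Fin n) (Fin n) ℂ) (c : ℝ) (X : CMapGroup n) (A : Fin n) :
    beta F (c • X) A = c * beta F X A := by
  simp only [beta, a_smul, b_smul, Pi.smul_apply, smul_eq_mul, Complex.ofReal_mul, mul_sub,
    Finset.mul_sum]
  congr 1
  exact Finset.sum_congr rfl fun B _ => by ring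

theorem beta_neg (F : Matrix (Fin n) (Fin n) ℂ) (X : CMapGroup n) (A : Fin n) :
    beta F (-X) A = -beta F X A := by
  rw [← neg_one_smul ℝ X, beta_smul]; simp

theorem beta_im (F : Matrix (Fin n) (Fin n) ℂ) (X : CMapGroup n) :
    (fun A => (beta F X A).im) = -(F.map Complex.im).mulVec X.a := by
  ext A; simp [beta, Matrix.mulVec, dotProduct]

theorem beta_re (F : Matrix (Fin n) (Fin n) ℂ) (X : CMapGroup n) :
    (fun A => (beta F X A).re) = X.b - (F.map Complex.re).mulVec X.a := by
  ext A; simp [beta, Matrix.mulVec, dotProduct]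

/-- A tangent vector is determined by its values under `dφ`, `theta` and `β_A`. -/
theorem ext_forms {F : Matrix (Fin n) (Fin n) ℂ} (hF : IsUnit (F.map Complex.im).det)
    {g X Y : CMapGroup n} (h1 : X.phi = Y.phi) (h2 : theta g X = theta g Y)
    (h3 : ∀ A, beta F X A = beta F Y A) : X = Y := by
  have ha : X.a = Y.a := by
    have h := beta_im F X
    simp only [h3] at h
    rw [beta_im F Y, neg_inj] at h
    exact ((Matrix.mulVec_injective_iff_isUnit.2
      ((Matrix.isUnit_iff_isUnit_det _).2 hF)) h).symm
  have hb : X.b = Y.b := by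
    have h := beta_re F X
    simp only [h3] at h
    rw [beta_re F Y, ha, sub_left_inj] at h
    exact h.symm
  have ht : X.tphi = Y.tphi := by
    simpa [theta, ha, hb] using h2
  exact coord_ext h1 ht (fun A => congrFun ha A) (fun A => congrFun hb A)

/-- The `a`-components of `J X`. -/
noncomputable def fibreJa (F : Matrix (Fin n) (Fin n) ℂ) (X : CMapGroup n) : Fin n → ℝ :=
  -- Solution of `Im β(JX) = Re β(X)`, that is `-N a' = b - (Re F) a`.
  (F.map Complex.im)⁻¹.mulVec ((F.map Complex.re).mulVec X.a - X.b)

/-- The `b`-components of `J X`. -/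
noncomputable def fibreJb (F : Matrix (Fin n) (Fin n) ℂ) (X : CMapGroup n) : Fin n → ℝ :=
  -- Solution of `Re β(JX) = -Im β(X)`, that is `b' - (Re F) a' = N a`.
  (F.map Complex.im).mulVec X.a + (F.map Complex.re).mulVec (fibreJa F X)

/-- The vector `J X`. -/
noncomputable def fibreJfun (F : Matrix (Fin n) (Fin n) ℂ) (g X : CMapGroup n) : CMapGroup n :=
  mk (-(1 / 2) * Real.exp (2 * g.phi) * theta g X)
    (2 * Real.exp (-2 * g.phi) * X.phi
      - ∑ A, (g.b A * fibreJa F X A - g.a A * fibreJb F X A))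
    (fibreJa F X) (fibreJb F X)

theorem phi_fibreJfun (F : Matrix (Fin n) (Fin n) ℂ) (g X : CMapGroup n) :
    (fibreJfun F g X).phi = -(1 / 2) * Real.exp (2 * g.phi) * theta g X := rfl

theorem theta_fibreJfun (F : Matrix (Fin n) (Fin n) ℂ) (g X : CMapGroup n) :
    theta g (fibreJfun F g X) = 2 * Real.exp (-2 * g.phi) * X.phi := by
  simp [theta, fibreJfun]

theorem beta_fibreJfun {F : Matrix (Fin n) (Fin n) ℂ} (hF : IsUnit (F.map Complex.im).det)
    (g X : CMapGroup n) (A : Fin n) :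
    beta F (fibreJfun F g X) A = Complex.I * beta F X A := by
  have h1 := congrFun (beta_im F (fibreJfun F g X)) A
  have h2 := congrFun (beta_re F (fibreJfun F g X)) A
  have h3 := congrFun (beta_im F X) A
  have h4 := congrFun (beta_re F X) A
  refine Complex.ext ?_ ?_
  · rw [h2, Complex.I_mul_re, h3]
    simp [fibreJfun, fibreJb]
  · rw [h1, Complex.I_mul_im, h4]
    simp [fibreJfun, fibreJa, Matrix.mulVec_mulVec, Matrix.mul_nonsing_inv _ hF]

/-- The endomorphism `J` of `T_g G` with `φ ∘ J = -½ e^{2φ} θ`, `θ ∘ J = 2 e^{-2φ} dφ` and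
`β ∘ J = i β`. -/
noncomputable def fibreJ (F : Matrix (Fin n) (Fin n) ℂ) (g : CMapGroup n) :
    CMapGroup n →L[ℝ] CMapGroup n :=
  LinearMap.toContinuousLinearMap
    { toFun := fibreJfun F g
      map_add' := fun X Y => by
        have ha : fibreJa F (X + Y) = fibreJa F X + fibreJa F Y := by
          simp only [fibreJa, a_add, b_add, Matrix.mulVec_add]
          rw [add_sub_add_comm, Matrix.mulVec_add]
        have hb : fibreJb F (X + Y) = fibreJb F X + fibreJb F Y := by
          simp only [fibreJb, ha, a_add, Matrix.mulVec_add]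
          abel
        refine coord_ext ?_ ?_ ?_ ?_
        · simp only [fibreJfun, phi_mk, phi_add, theta_add]; ring
        · simp only [fibreJfun, tphi_mk, tphi_add, phi_add, ha, hb, Pi.add_apply]
          rw [sub_add_sub_comm, ← Finset.sum_add_distrib]
          congr 1
          · ring
          · exact Finset.sum_congr rfl fun A _ => by ring
        · intro A; simp [fibreJfun, ha]
        · intro A; simp [fibreJfun, hb]
      map_smul' := fun c X => by
        have ha : fibreJa F (c • X) = c • fibreJa F X := by
          simp only [fibreJa, a_smul, b_smul, Matrix.mulVec_smul, ← smul_sub]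
        have hb : fibreJb F (c • X) = c • fibreJb F X := by
          simp only [fibreJb, ha, a_smul, Matrix.mulVec_smul, smul_add]
        refine coord_ext ?_ ?_ ?_ ?_
        · simp only [fibreJfun, phi_mk, phi_smul, theta_smul, RingHom.id_apply]; ring
        · simp only [fibreJfun, tphi_mk, tphi_smul, phi_smul, ha, hb, Pi.smul_apply,
            smul_eq_mul, RingHom.id_apply, mul_sub, Finset.mul_sum]
          congr 1
          · ring
          · exact Finset.sum_congr rfl fun A _ => by ring
        · intro A; simp [fibreJfun, ha]
        · intro A; simp [fibreJfun, hb] }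

theorem fibreJ_apply (F : Matrix (Fin n) (Fin n) ℂ) (g X : CMapGroup n) :
    fibreJ F g X = fibreJfun F g X := rfl

theorem fibreJ_fibreJ {F : Matrix (Fin n) (Fin n) ℂ} (hF : IsUnit (F.map Complex.im).det)
    (g X : CMapGroup n) : fibreJ F g (fibreJ F g X) = -X := by
  have e : Real.exp (2 * g.phi) * Real.exp (-2 * g.phi) = 1 := by
    rw [← Real.exp_add]; simp
  simp only [fibreJ_apply]
  refine ext_forms hF (g := g) ?_ ?_ fun A => ?_
  · rw [phi_fibreJfun, theta_fibreJfun, phi_neg]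
    linear_combination -X.phi * e
  · rw [theta_fibreJfun, phi_fibreJfun, theta_neg]
    linear_combination -theta g X * e
  · rw [beta_fibreJfun hF, beta_fibreJfun hF, beta_neg, ← mul_assoc, Complex.I_mul_I]; ring

/-- Under translation by `g` the form `dφ` is invariant while `θ` and `β` scale by `e^{-2φ(g)}` and
`e^{-φ(g)}`. The factors `e^{±2φ}` in the relations characterising `J` absorb the first scaling, and
`β ∘ J = iβ` is unaffected by the second. -/
theorem isLeftInvariant_fibreJ {F : Matrix (Fin n) (Fin n) ℂ}
    (hF : IsUnit (F.map Complex.im).det) : IsLeftInvariant (fibreJ F) := by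
  intro g h X
  have hbeta : ∀ (k Y : CMapGroup n) (A : Fin n),
      beta F (fderiv ℝ (fun h' => g * h') k Y) A = Real.exp (-g.phi) * beta F Y A := by
    intro k Y A
    rw [fderiv_mul_left, ← beta_smul]
    rfl
  have hphi : ∀ k Y : CMapGroup n, (fderiv ℝ (fun h' => g * h') k Y).phi = Y.phi := by
    intro k Y
    rw [fderiv_mul_left]
    rfl
  simp only [fibreJ_apply]
  refine ext_forms hF (g := g * h) ?_ ?_ fun A => ?_
  · have e : Real.exp (2 * (g.phi + h.phi)) * Real.exp (-2 * g.phi) = Real.exp (2 * h.phi) := by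
      rw [← Real.exp_add]; ring_nf
    rw [hphi, phi_fibreJfun, phi_fibreJfun, theta_fderiv_mul_left, phi_mul]
    linear_combination (1 / 2) * theta h X * e
  · have e : Real.exp (-2 * (g.phi + h.phi)) = Real.exp (-2 * g.phi) * Real.exp (-2 * h.phi) := by
      rw [← Real.exp_add]; ring_nf
    rw [theta_fderiv_mul_left, theta_fibreJfun, theta_fibreJfun, hphi, phi_mul, e]
    ring
  · rw [hbeta, beta_fibreJfun hF, beta_fibreJfun hF, hbeta]; ring

end CMapGroup

/-! ### The structure `J3`: compatibility with the vielbein and uniqueness -/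

namespace SpecialKahlerDomain

open CMapGroup

variable {m : ℕ} (S : SpecialKahlerDomain m)

/-- The matrix `(F_{AB})` at `Z = (z, 1)`. -/
noncomputable def FMat (z : Fin m → ℂ) : Matrix (Fin (m + 1)) (Fin (m + 1)) ℂ :=
  Matrix.of (S.FAB z)

theorem FMat_apply (z : Fin m → ℂ) (A B : Fin (m + 1)) : S.FMat z A B = S.FAB z A B := rfl

theorem FMat_map_im (z : Fin m → ℂ) : (S.FMat z).map Complex.im = S.N z := rfl

/-- A real matrix `P` with `Pᵀ N P = diag(-1, …, -1, 1)` gives `N⁻¹ = P diag(-1, …, -1, 1) Pᵀ`. -/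
theorem mul_signature_eq_one {N P : Matrix (Fin (m + 1)) (Fin (m + 1)) ℝ}
    (h : P.transpose * N * P = Matrix.diagonal (fun A => if A = Fin.last m then 1 else -1)) :
    N * (P * Matrix.diagonal (fun A => if A = Fin.last m then 1 else -1) * P.transpose) = 1 := by
  have hD : (Matrix.diagonal (fun A => if A = Fin.last m then 1 else -1) :
      Matrix (Fin (m + 1)) (Fin (m + 1)) ℝ) *
        Matrix.diagonal (fun A => if A = Fin.last m then 1 else -1) = 1 := by
    rw [Matrix.diagonal_mul_diagonal, ← Matrix.diagonal_one]
    congr 1; ext A; split_ifs <;> norm_num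
  have key : P.transpose * (N * P *
      Matrix.diagonal (fun A => if A = Fin.last m then 1 else -1)) = 1 := by
    rw [← Matrix.mul_assoc, ← Matrix.mul_assoc, h, hD]
  -- A one-sided inverse of a square matrix is two-sided, so `Pᵀ` can be moved to the right end.
  rw [mul_eq_one_comm] at key
  simpa only [Matrix.mul_assoc] using key

theorem isUnit_det_N {z : Fin m → ℂ} (hz : z ∈ S.Msk) : IsUnit (S.N z).det := by
  obtain ⟨P, -, hP⟩ := S.signature _ hz
  exact Matrix.isUnit_det_of_right_inverse (mul_signature_eq_one hP)

/-- The almost complex structure `J_3 = J + J_G`. -/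
noncomputable def J3 (x : CMapSpace m) : CMapSpace m →L[ℝ] CMapSpace m :=
  (Complex.I • ContinuousLinearMap.fst ℝ (Fin m → ℂ) (CMapGroup (m + 1))).prod
    ((fibreJ (S.FMat x.1) x.2).comp (ContinuousLinearMap.snd ℝ (Fin m → ℂ) (CMapGroup (m + 1))))

theorem J3_apply (x X : CMapSpace m) :
    S.J3 x X = (Complex.I • X.1, fibreJ (S.FMat x.1) x.2 X.2) := rfl

theorem formU_eq (x X : CMapSpace m) : S.formU x X =
    Complex.I * (Real.exp (S.K x.1 / 2 + x.2.phi) : ℂ) *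
      ∑ A, hom x.1 A * beta (S.FMat x.1) X.2 A := rfl

/-- In this form `J3` visibly rotates the real and imaginary parts of `v` into each other. -/
theorem formV_eq (x X : CMapSpace m) : formV x X =
    -(X.2.phi : ℂ) + Complex.I * ((1 / 2 * Real.exp (2 * x.2.phi) * theta x.2 X.2 : ℝ) : ℂ) := by
  have e : (Real.exp (2 * x.2.phi) : ℂ) * (Real.exp (-2 * x.2.phi) : ℂ) = 1 := by
    rw [← Complex.ofReal_mul, ← Real.exp_add]; simp
  rw [formV, theta]
  push_cast at e ⊢
  linear_combination -(X.2.phi : ℂ) * e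

/-- Since `da` and `db` are real, the conjugated `F_{BC}` produces `conj(β_B)`; hence `E^b` has type
`(0,1)`. -/
theorem formE_eq (e : (Fin m → ℂ) → Matrix (Fin m) (Fin m) ℂ) (b : Fin m) (x X : CMapSpace m) :
    S.formE e b x X = -(Complex.I / 2) * (Real.exp (x.2.phi - S.K x.1 / 2) : ℂ) *
      ∑ A, ∑ B, PiCoeff e x.1 b A * (((S.N x.1)⁻¹ A B : ℝ) : ℂ) *
        conj (beta (S.FMat x.1) X.2 B) := by
  simp only [formE, beta, map_sub, map_sum, map_mul, Complex.conj_ofReal, FMat_apply]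

theorem formU_J3 {x : CMapSpace m} (hx : x ∈ S.M) (X : CMapSpace m) :
    S.formU x (S.J3 x X) = Complex.I * S.formU x X := by
  simp only [formU_eq, J3_apply, fibreJ_apply,
    beta_fibreJfun (F := S.FMat x.1) (S.isUnit_det_N hx.1), Finset.mul_sum]
  exact Finset.sum_congr rfl fun A _ => by ring

theorem formV_J3 (x X : CMapSpace m) :
    formV x (S.J3 x X) = -Complex.I * formV x X := by
  have e : (Real.exp (2 * x.2.phi) : ℂ) * (Real.exp (-2 * x.2.phi) : ℂ) = 1 := by
    rw [← Complex.ofReal_mul, ← Real.exp_add]; simp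
  rw [formV_eq, formV_eq]
  simp only [J3_apply, fibreJ_apply, phi_fibreJfun, theta_fibreJfun]
  push_cast at e ⊢
  linear_combination Complex.I * (X.2.phi : ℂ) * e
    + (1 / 2 * Complex.exp (2 * x.2.phi) * theta x.2 X.2) * Complex.I_mul_I

theorem forme_J3 (e : (Fin m → ℂ) → Matrix (Fin m) (Fin m) ℂ) (b : Fin m) (x X : CMapSpace m) :
    forme e b x (S.J3 x X) = Complex.I * forme e b x X := by
  simp only [forme, J3_apply, Pi.smul_apply, smul_eq_mul, Finset.mul_sum]
  exact Finset.sum_congr rfl fun A _ => by ring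

theorem formE_J3 (e : (Fin m → ℂ) → Matrix (Fin m) (Fin m) ℂ) (b : Fin m) {x : CMapSpace m}
    (hx : x ∈ S.M) (X : CMapSpace m) :
    S.formE e b x (S.J3 x X) = -Complex.I * S.formE e b x X := by
  simp only [formE_eq, J3_apply, fibreJ_apply,
    beta_fibreJfun (F := S.FMat x.1) (S.isUnit_det_N hx.1), Finset.mul_sum, map_mul,
    Complex.conj_I]
  exact Finset.sum_congr rfl fun A _ => Finset.sum_congr rfl fun B _ => by ring

/-- The index `2` selects the diagonal matrix `σ_3`, so the rows do not mix: the first consists of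
`(0,1)`-forms and the second of `(1,0)`-forms. -/
theorem isCMapJ_J3 (e : (Fin m → ℂ) → Matrix (Fin m) (Fin m) ℂ) : S.IsCMapJ e 2 S.J3 := by
  intro x hx i k X
  fin_cases i <;> rcases k with (k | k) | (k | k) <;>
    simp [vielbein, pauli, S.formU_J3 hx, S.formV_J3, S.forme_J3, S.formE_J3 e _ hx] <;> ring

/-- The linear system `Z^A δ_A = 0`, `Π_A^b N^{AB} conj(δ_B) = 0` has only the trivial solution. -/
theorem eq_zero_of_forms {e : (Fin m → ℂ) → Matrix (Fin m) (Fin m) ℂ} {z : Fin m → ℂ}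
    (hz : z ∈ S.Msk) (he : IsUnit (e z).det) {δ : Fin (m + 1) → ℂ}
    (h1 : ∑ A, hom z A * δ A = 0)
    (h2 : ∀ b, ∑ A, ∑ B, PiCoeff e z b A * (((S.N z)⁻¹ A B : ℝ) : ℂ) * conj (δ B) = 0) :
    δ = 0 := by
  -- With `γ = N⁻¹ conj(δ)` the second system reads `∑ Π_A^b γ^A = 0`, and `conj(δ) = N γ` recovers
  -- `δ`.
  set γ : Fin (m + 1) → ℂ := fun A => ∑ B, (((S.N z)⁻¹ A B : ℝ) : ℂ) * conj (δ B) with hγ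
  have hγN : ∀ B, conj (δ B) = ∑ A, (S.N z B A : ℂ) * γ A := by
    intro B
    simp only [hγ, Finset.mul_sum]
    rw [Finset.sum_comm]
    have hN : ∀ C, ∑ A, (S.N z B A : ℂ) * (((S.N z)⁻¹ A C : ℝ) : ℂ) = if B = C then 1 else 0 := by
      intro C
      have h := congrFun (congrFun (Matrix.mul_nonsing_inv _ (S.isUnit_det_N hz)) B) C
      rw [Matrix.mul_apply, Matrix.one_apply] at h
      have h' := congrArg (fun t : ℝ => (t : ℂ)) h
      push_cast at h'
      rw [h']
      split_ifs <;> simp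
    simp only [← mul_assoc, ← Finset.sum_mul, hN]
    simp
  -- By the definition of `Π`, `∑ Π_A^b γ^A = ∑ e_a^b (γ^a - z^a γ^n)`. As `(e_a^b)` is invertible,
  -- the kernel of `Π` is the line spanned by `Z`.
  have hvec : Matrix.vecMul (fun a => γ a.castSucc - z a * γ (Fin.last m)) (e z) = 0 := by
    ext b
    have h := h2 b
    simp only [mul_assoc, ← Finset.mul_sum] at h
    rw [Fin.sum_univ_castSucc] at h
    simp only [PiCoeff, Fin.snoc_castSucc, Fin.snoc_last, neg_mul, Finset.sum_mul] at h
    rw [← sub_eq_add_neg, ← Finset.sum_sub_distrib] at h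
    rw [Matrix.vecMul, dotProduct, Pi.zero_apply, ← h]
    exact Finset.sum_congr rfl fun a _ => by simp only [hγ]; ring
  have hzero : (fun a => γ a.castSucc - z a * γ (Fin.last m)) = 0 :=
    Matrix.vecMul_injective_iff_isUnit.2 ((Matrix.isUnit_iff_isUnit_det _).2 he)
      (hvec.trans (Matrix.zero_vecMul _).symm)
  have hγZ : ∀ A, γ A = γ (Fin.last m) * hom z A := by
    intro A
    induction A using Fin.lastCases with
    | last => simp [hom]
    | cast a =>
      have := congrFun hzero a
      simp only [Pi.zero_apply, sub_eq_zero] at this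
      rw [this]; simp [hom, mul_comm]
  -- Inserting `γ = γ^n Z` into the conjugate of `∑ Z^A δ_A = 0` leaves `γ^n` times the conjugate of
  -- the norm of `Z`, which is nonzero.
  have hnorm : γ (Fin.last m) *
      conj (∑ A, ∑ B, hom z A * (prepotentialN S.F (hom z) A B : ℂ) * conj (hom z B)) = 0 := by
    have h := congrArg conj h1
    rw [map_sum, map_zero] at h
    rw [← h, map_sum, Finset.mul_sum]
    refine Finset.sum_congr rfl fun A _ => ?_
    rw [map_mul, hγN, map_sum, Finset.mul_sum, Finset.mul_sum]
    refine Finset.sum_congr rfl fun B _ => ?_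
    rw [hγZ B]
    simp only [map_mul, Complex.conj_conj, Complex.conj_ofReal, N]
    ring
  have hne : (∑ A, ∑ B, hom z A * (prepotentialN S.F (hom z) A B : ℂ) * conj (hom z B)) ≠ 0 := by
    intro h0
    have := S.norm_pos _ hz
    rw [prepotentialNorm, h0] at this
    simp at this
  have hlast : γ (Fin.last m) = 0 :=
    (mul_eq_zero.1 hnorm).resolve_right ((map_ne_zero _).2 hne)
  ext B
  have h := hγN B
  simp only [fun A => (hγZ A).trans (by rw [hlast, zero_mul] : _ = (0 : ℂ)), mul_zero,
    Finset.sum_const_zero] at h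
  simpa using h

/-- The forms `e^b` determine the base component, `u` and `E^b` together determine `β`, and `v`
determines `dφ` and `θ`. This injectivity forces uniqueness of `J_3`. -/
theorem ext_vielbein {e : (Fin m → ℂ) → Matrix (Fin m) (Fin m) ℂ} {x : CMapSpace m}
    (hx : x ∈ S.M) (he : IsUnit (e x.1).det) {X Y : CMapSpace m}
    (h : ∀ i k, S.vielbein e x i k X = S.vielbein e x i k Y) : X = Y := by
  have hc : ((1 / Real.sqrt 2 : ℝ) : ℂ) ≠ 0 := by
    rw [Complex.ofReal_ne_zero]; positivity
  have h' := fun i k => mul_left_cancel₀ hc (h i k)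
  have hU : S.formU x X = S.formU x Y := by simpa using h' 1 (Sum.inr (Sum.inl ()))
  have hV : formV x X = formV x Y := by simpa using h' 0 (Sum.inr (Sum.inl ()))
  have hee : ∀ b, forme e b x X = forme e b x Y := fun b => by
    simpa using h' 1 (Sum.inr (Sum.inr b))
  have hE : ∀ b, S.formE e b x X = S.formE e b x Y := fun b => by
    simpa using h' 0 (Sum.inr (Sum.inr b))
  refine Prod.ext ?_ ?_
  · refine Matrix.vecMul_injective_iff_isUnit.2 ((Matrix.isUnit_iff_isUnit_det _).2 he)
      (funext fun b => ?_)
    simpa [Matrix.vecMul, dotProduct, forme, mul_comm] using hee b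
  · have hbeta : (fun A => beta (S.FMat x.1) X.2 A - beta (S.FMat x.1) Y.2 A) = 0 := by
      refine S.eq_zero_of_forms hx.1 he ?_ fun b => ?_
      · rw [formU_eq, formU_eq] at hU
        have := mul_left_cancel₀ (mul_ne_zero Complex.I_ne_zero
          (Complex.ofReal_ne_zero.2 (Real.exp_ne_zero _))) hU
        simp only [mul_sub, Finset.sum_sub_distrib, this, sub_self]
      · have hb := hE b
        rw [formE_eq, formE_eq] at hb
        have := mul_left_cancel₀ (mul_ne_zero
          (neg_ne_zero.2 (div_ne_zero Complex.I_ne_zero two_ne_zero))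
          (Complex.ofReal_ne_zero.2 (Real.exp_ne_zero _))) hb
        simp only [map_sub, mul_sub, Finset.sum_sub_distrib, this, sub_self]
    rw [formV_eq, formV_eq] at hV
    refine ext_forms (F := S.FMat x.1) (S.isUnit_det_N hx.1) (g := x.2) ?_ ?_
      fun A => sub_eq_zero.1 (congrFun hbeta A)
    · have := congrArg Complex.re hV
      simp only [Complex.add_re, Complex.neg_re, Complex.ofReal_re, Complex.I_mul_re,
        Complex.ofReal_im, neg_zero, add_zero, neg_inj] at this
      exact this
    · have := congrArg Complex.im hV
      simp only [Complex.add_im, Complex.neg_im, Complex.ofReal_im, neg_zero, zero_add,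
        Complex.I_mul_im, Complex.ofReal_re] at this
      exact mul_left_cancel₀ (by positivity) this

theorem eq_J3_of_isCMapJ {e : (Fin m → ℂ) → Matrix (Fin m) (Fin m) ℂ} (he : S.IsVielbein e)
    {J' : CMapSpace m → CMapSpace m →L[ℝ] CMapSpace m} (hJ : S.IsCMapJ e 2 J')
    {x : CMapSpace m} (hx : x ∈ S.M) : J' x = S.J3 x := by
  refine ContinuousLinearMap.ext fun X => ?_
  exact S.ext_vielbein hx (he.coframe _ hx.1) fun i k =>
    (hJ x hx i k X).trans (S.isCMapJ_J3 e x hx i k X).symm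

end SpecialKahlerDomain

/-! ### Smooth dependence of matrix operations on parameters -/

theorem contDiffOn_matrix_mulVec {E ι : Type*} [NormedAddCommGroup E] [NormedSpace ℝ E]
    [Fintype ι] {k : WithTop ℕ∞} {s : Set E} {M : E → Matrix ι ι ℝ} {v : E → ι → ℝ}
    (h : ∀ i j, ContDiffOn ℝ k (fun x => M x i j) s)
    (hv : ∀ j, ContDiffOn ℝ k (fun x => v x j) s) (i : ι) :
    ContDiffOn ℝ k (fun x => (M x).mulVec (v x) i) s := by
  simp only [Matrix.mulVec, dotProduct]
  exact ContDiffOn.sum fun j _ => (h i j).mul (hv j)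

section MatrixSmooth

variable {E ι : Type*} [NormedAddCommGroup E] [NormedSpace ℝ E] [Fintype ι] [DecidableEq ι]
  {k : WithTop ℕ∞} {s : Set E}

theorem contDiffOn_matrix_det {M : E → Matrix ι ι ℝ}
    (h : ∀ i j, ContDiffOn ℝ k (fun x => M x i j) s) :
    ContDiffOn ℝ k (fun x => (M x).det) s := by
  simp only [Matrix.det_apply']
  exact ContDiffOn.sum fun σ _ => contDiffOn_const.mul (contDiffOn_prod fun i _ => h _ _)

theorem contDiffOn_matrix_inv {M : E → Matrix ι ι ℝ}
    (h : ∀ i j, ContDiffOn ℝ k (fun x => M x i j) s) (hM : ∀ x ∈ s, IsUnit (M x).det) (i j : ι) :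
    ContDiffOn ℝ k (fun x => (M x)⁻¹ i j) s := by
  simp only [Matrix.inv_def, Matrix.smul_apply, Ring.inverse_eq_inv', smul_eq_mul,
    Matrix.adjugate_apply]
  refine ((contDiffOn_matrix_det h).inv fun x hx => (hM x hx).ne_zero).mul
    (contDiffOn_matrix_det fun p q => ?_)
  simp only [Matrix.updateRow_apply]
  split_ifs
  · exact contDiffOn_const
  · exact h p q

end MatrixSmooth

/-! ### Regularity and symmetry of `F_{AB}` -/

namespace SpecialKahlerDomain

open CMapGroup

variable {m : ℕ} (S : SpecialKahlerDomain m)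

theorem differentiableOn_hessian (A B : Fin (m + 1)) :
    DifferentiableOn ℂ (fun Z => prepotentialHessian S.F Z A B) S.Mask :=
  differentiableOn_fderiv_apply S.isOpen_Mask
    (differentiableOn_fderiv_apply S.isOpen_Mask S.holomorphic _) _

theorem hessian_symm {Z : Fin (m + 1) → ℂ} (hZ : Z ∈ S.Mask) (A B : Fin (m + 1)) :
    prepotentialHessian S.F Z A B = prepotentialHessian S.F Z B A := by
  have hC : ContDiffAt ℂ ∞ S.F Z :=
    (contDiffOn_of_differentiableOn_complex S.isOpen_Mask S.holomorphic).contDiffAt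
      (S.isOpen_Mask.mem_nhds hZ)
  have hd : DifferentiableAt ℂ (fderiv ℂ S.F) Z :=
    (hC.fderiv_right (m := 1) (by norm_cast)).differentiableAt one_ne_zero
  have hH : ∀ A B, prepotentialHessian S.F Z A B =
      fderiv ℂ (fderiv ℂ S.F) Z (Pi.single B 1) (Pi.single A 1) := by
    intro A B
    rw [prepotentialHessian, fderiv_clm_apply hd (differentiableAt_const _)]
    simp
  rw [hH, hH]
  exact hC.isSymmSndFDerivAt (by rw [minSmoothness_of_isRCLikeNormedField]; norm_cast) _ _

theorem differentiable_hom : Differentiable ℂ (hom : (Fin m → ℂ) → Fin (m + 1) → ℂ) := by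
  rw [differentiable_pi]
  intro A
  induction A using Fin.lastCases with
  | last => simp [hom]
  | cast a => simpa [hom] using differentiable_apply a

theorem isOpen_Msk : IsOpen S.Msk :=
  S.isOpen_Mask.preimage differentiable_hom.continuous

theorem differentiableOn_FAB (A B : Fin (m + 1)) :
    DifferentiableOn ℂ (fun z => S.FAB z A B) S.Msk :=
  (S.differentiableOn_hessian A B).comp differentiable_hom.differentiableOn fun _ hz => hz

theorem FAB_symm {z : Fin m → ℂ} (hz : z ∈ S.Msk) (A B : Fin (m + 1)) :
    S.FAB z A B = S.FAB z B A :=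
  S.hessian_symm hz A B

theorem contDiffOn_FAB (A B : Fin (m + 1)) :
    ContDiffOn ℝ ∞ (fun z => S.FAB z A B) S.Msk :=
  (contDiffOn_of_differentiableOn_complex S.isOpen_Msk (S.differentiableOn_FAB A B)).restrict_scalars
    ℝ

theorem contDiffOn_re_FAB (A B : Fin (m + 1)) :
    ContDiffOn ℝ ∞ (fun z => (S.FAB z A B).re) S.Msk :=
  Complex.reCLM.contDiff.comp_contDiffOn (S.contDiffOn_FAB A B)

theorem contDiffOn_N (A B : Fin (m + 1)) : ContDiffOn ℝ ∞ (fun z => S.N z A B) S.Msk :=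
  Complex.imCLM.contDiff.comp_contDiffOn (S.contDiffOn_FAB A B)

theorem contDiffOn_N_inv (A B : Fin (m + 1)) : ContDiffOn ℝ ∞ (fun z => (S.N z)⁻¹ A B) S.Msk :=
  contDiffOn_matrix_inv S.contDiffOn_N (fun _ hz => S.isUnit_det_N hz) A B

theorem hasFDerivAt_FAB {z : Fin m → ℂ} (hz : z ∈ S.Msk) (A B : Fin (m + 1)) :
    HasFDerivAt (fun z => S.FAB z A B)
      ((fderiv ℂ (fun z => S.FAB z A B) z).restrictScalars ℝ) z :=
  (((S.differentiableOn_FAB A B).differentiableAt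
    (S.isOpen_Msk.mem_nhds hz)).hasFDerivAt).restrictScalars ℝ

/-! ### The differential of `Ψ` -/

/-- `dw_A = β_A - ∑ a^B dF_{AB}`; the second term is of type `(1,0)` because `F_{AB}` is holomorphic
in `z`. -/
theorem exists_hasFDerivAt_w {x : CMapSpace m} (hx : x ∈ S.M) (A : Fin (m + 1)) :
    ∃ L : CMapSpace m →L[ℝ] ℂ, HasFDerivAt (fun x => S.w x A) L x ∧ ∀ X : CMapSpace m,
      L X = beta (S.FMat x.1) X.2 A
        - ∑ B, fderiv ℂ (fun z => S.FAB z A B) x.1 X.1 * (x.2.a B : ℂ) := by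
  have hb : HasFDerivAt (fun y : CMapSpace m => (y.2.b A : ℂ))
      (Complex.ofRealCLM.comp ((ContinuousLinearMap.proj A).comp
        ((bL (n := m + 1)).comp (ContinuousLinearMap.snd ℝ (Fin m → ℂ) (CMapGroup (m + 1)))))) x :=
    (Complex.ofRealCLM.comp ((ContinuousLinearMap.proj (R := ℝ) (φ := fun _ => ℝ) A).comp
        (bL.comp (ContinuousLinearMap.snd ℝ (Fin m → ℂ) (CMapGroup (m + 1)))))).hasFDerivAt
  have ha : ∀ B, HasFDerivAt (fun y : CMapSpace m => (y.2.a B : ℂ))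
      (Complex.ofRealCLM.comp ((ContinuousLinearMap.proj B).comp
        ((aL (n := m + 1)).comp (ContinuousLinearMap.snd ℝ (Fin m → ℂ) (CMapGroup (m + 1)))))) x :=
    fun B => (Complex.ofRealCLM.comp ((ContinuousLinearMap.proj (R := ℝ) (φ := fun _ => ℝ) B).comp
        (aL.comp (ContinuousLinearMap.snd ℝ (Fin m → ℂ) (CMapGroup (m + 1)))))).hasFDerivAt
  have hF : ∀ B, HasFDerivAt (fun y : CMapSpace m => S.FAB y.1 A B)
      (((fderiv ℂ (fun z => S.FAB z A B) x.1).restrictScalars ℝ).comp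
        (ContinuousLinearMap.fst ℝ (Fin m → ℂ) (CMapGroup (m + 1)))) x := fun B =>
    (S.hasFDerivAt_FAB hx.1 A B).comp x hasFDerivAt_fst
  refine ⟨_, hb.sub (HasFDerivAt.fun_sum fun B (_ : B ∈ Finset.univ) => (hF B).mul (ha B)),
    fun X => ?_⟩
  simp [beta, FMat_apply, Finset.sum_add_distrib, mul_comm]
  ring

/-- `dw^0 = 2 e^{-2φ} conj(v) - 2i ∑ a^A β_A + i ∑ a^A a^B dF_{AB}`, a sum of `(1,0)`-forms. -/
theorem exists_hasFDerivAt_w0 {x : CMapSpace m} (hx : x ∈ S.M) :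
    ∃ L : CMapSpace m →L[ℝ] ℂ, HasFDerivAt S.w0 L x ∧ ∀ X : CMapSpace m,
      L X = -2 * (Real.exp (-2 * x.2.phi) * X.2.phi : ℝ) - Complex.I * (theta x.2 X.2 : ℝ)
        - 2 * Complex.I * ∑ A, (x.2.a A : ℂ) * beta (S.FMat x.1) X.2 A
        + Complex.I * ∑ A, ∑ B, (x.2.a A : ℂ) *
          (fderiv ℂ (fun z => S.FAB z A B) x.1 X.1 * (x.2.a B : ℂ)) := by
  choose L hL hLX using S.exists_hasFDerivAt_w hx
  have ha : ∀ B, HasFDerivAt (fun y : CMapSpace m => (y.2.a B : ℂ))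
      (Complex.ofRealCLM.comp ((ContinuousLinearMap.proj B).comp
        ((aL (n := m + 1)).comp (ContinuousLinearMap.snd ℝ (Fin m → ℂ) (CMapGroup (m + 1)))))) x :=
    fun B => (Complex.ofRealCLM.comp ((ContinuousLinearMap.proj (R := ℝ) (φ := fun _ => ℝ) B).comp
        (aL.comp (ContinuousLinearMap.snd ℝ (Fin m → ℂ) (CMapGroup (m + 1)))))).hasFDerivAt
  have ht : HasFDerivAt (fun y : CMapSpace m => (y.2.tphi : ℂ))
      (Complex.ofRealCLM.comp ((tphiL (n := m + 1)).comp
        (ContinuousLinearMap.snd ℝ (Fin m → ℂ) (CMapGroup (m + 1))))) x :=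
    (Complex.ofRealCLM.comp (tphiL.comp
      (ContinuousLinearMap.snd ℝ (Fin m → ℂ) (CMapGroup (m + 1))))).hasFDerivAt
  have hp : HasFDerivAt (fun y : CMapSpace m => y.2.phi)
      ((phiL (n := m + 1)).comp (ContinuousLinearMap.snd ℝ (Fin m → ℂ) (CMapGroup (m + 1)))) x :=
    (phiL.comp (ContinuousLinearMap.snd ℝ (Fin m → ℂ) (CMapGroup (m + 1)))).hasFDerivAt
  have he : HasFDerivAt (fun y : CMapSpace m => ((Real.exp (-2 * y.2.phi) : ℝ) : ℂ)) _ x :=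
    Complex.ofRealCLM.hasFDerivAt.comp x (hp.const_mul (-2)).exp
  refine ⟨_, he.sub ((ht.add (HasFDerivAt.fun_sum fun B (_ : B ∈ Finset.univ) =>
    (ha B).mul (hL B))).const_mul Complex.I), fun X => ?_⟩
  -- Symmetry of `F_{AB}` merges the two quadratic terms `∑ a^A F_{AB} da^B`; the remainder is the
  -- non-exact part of `θ`.
  have hsym : ∑ A, S.w x A * (X.2.a A : ℂ) + ∑ A, (x.2.a A : ℂ) * beta (S.FMat x.1) X.2 A =
      ((∑ A, (x.2.b A * X.2.a A - x.2.a A * X.2.b A) : ℝ) : ℂ)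
        + 2 * ∑ A, (x.2.a A : ℂ) * beta (S.FMat x.1) X.2 A := by
    have h1 : ∑ A, (∑ B, S.FAB x.1 A B * (x.2.a B : ℂ)) * (X.2.a A : ℂ) =
        ∑ A, (x.2.a A : ℂ) * ∑ B, S.FAB x.1 A B * (X.2.a B : ℂ) := by
      simp only [Finset.sum_mul, Finset.mul_sum]
      rw [Finset.sum_comm]
      refine Finset.sum_congr rfl fun A _ => Finset.sum_congr rfl fun B _ => ?_
      rw [S.FAB_symm hx.1 B A]; ring
    simp only [w, beta, FMat_apply, sub_mul, mul_sub, Finset.sum_sub_distrib, h1]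
    push_cast
    simp only [mul_comm]
    ring
  have hsplit : ∑ A, (x.2.a A : ℂ) * L A X = ∑ A, (x.2.a A : ℂ) * beta (S.FMat x.1) X.2 A
      - ∑ A, ∑ B, (x.2.a A : ℂ) *
          (fderiv ℂ (fun z => S.FAB z A B) x.1 X.1 * (x.2.a B : ℂ)) := by
    simp only [hLX, mul_sub, Finset.sum_sub_distrib, Finset.mul_sum]
  simp only [theta, sub_apply, add_apply,
    smul_apply, ContinuousLinearMap.comp_apply, sum_apply,
    Complex.ofRealCLM_apply, ContinuousLinearMap.proj_apply, ContinuousLinearMap.coe_snd', aL_apply,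
    tphiL_apply, phiL_apply, smul_eq_mul, Finset.sum_add_distrib, hsplit]
  push_cast at hsym ⊢
  linear_combination (-Complex.I) * hsym

theorem exists_hasFDerivAt_Psi {x : CMapSpace m} (hx : x ∈ S.M) :
    ∃ L : CMapSpace m →L[ℝ] (Fin m → ℂ) × (ℂ × (Fin (m + 1) → ℂ)), HasFDerivAt S.Psi L x ∧
      ∀ X : CMapSpace m, L (S.J3 x X) = Complex.I • L X := by
  obtain ⟨L0, hL0, hLX0⟩ := S.exists_hasFDerivAt_w0 hx
  choose L hL hLX using S.exists_hasFDerivAt_w hx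
  refine ⟨_, (hasFDerivAt_fst (p := x)).prodMk (hL0.prodMk (hasFDerivAt_pi.2 hL)), fun X => ?_⟩
  refine Prod.ext ?_ (Prod.ext ?_ (funext fun A => ?_))
  · rfl
  · change L0 (S.J3 x X) = Complex.I * L0 X
    have e : Real.exp (2 * x.2.phi) * Real.exp (-2 * x.2.phi) = 1 := by
      rw [← Real.exp_add]; simp
    have h1 : Real.exp (-2 * x.2.phi) * (fibreJfun (S.FMat x.1) x.2 X.2).phi =
        -(1 / 2) * theta x.2 X.2 := by
      rw [phi_fibreJfun]; linear_combination -(1 / 2) * theta x.2 X.2 * e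
    rw [hLX0, hLX0]
    simp only [J3_apply, fibreJ_apply, h1, theta_fibreJfun,
      beta_fibreJfun (F := S.FMat x.1) (S.isUnit_det_N hx.1), map_smul, smul_eq_mul]
    have h2 : ∑ A, (x.2.a A : ℂ) * (Complex.I * beta (S.FMat x.1) X.2 A) =
        Complex.I * ∑ A, (x.2.a A : ℂ) * beta (S.FMat x.1) X.2 A := by
      rw [Finset.mul_sum]; exact Finset.sum_congr rfl fun A _ => by ring
    have h3 : ∑ A, ∑ B, (x.2.a A : ℂ) *
          (Complex.I * fderiv ℂ (fun z => S.FAB z A B) x.1 X.1 * (x.2.a B : ℂ)) =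
        Complex.I * ∑ A, ∑ B, (x.2.a A : ℂ) *
          (fderiv ℂ (fun z => S.FAB z A B) x.1 X.1 * (x.2.a B : ℂ)) := by
      simp only [Finset.mul_sum]
      exact Finset.sum_congr rfl fun A _ => Finset.sum_congr rfl fun B _ => by ring
    rw [h2, h3]
    push_cast
    linear_combination (theta x.2 X.2 : ℂ) * Complex.I_mul_I
  · change L A (S.J3 x X) = Complex.I * L A X
    rw [hLX, hLX, J3_apply, fibreJ_apply,
      beta_fibreJfun (F := S.FMat x.1) (S.isUnit_det_N hx.1), mul_sub, Finset.mul_sum]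
    congr 1
    refine Finset.sum_congr rfl fun B _ => ?_
    simp only [map_smul, smul_eq_mul]
    ring

end SpecialKahlerDomain

/-! ### Biholomorphic maps and global charts -/

theorem IsBiholomorphicOnto.comp_equiv {E V : Type*} [NormedAddCommGroup E] [NormedSpace ℝ E]
    [NormedAddCommGroup V] [NormedSpace ℝ V] [NormedSpace ℂ V] [IsScalarTower ℝ ℂ V]
    {J : E → E →L[ℝ] E} {f : E → V} {S : Set E} {T T' : Set V}
    (hf : IsBiholomorphicOnto J f S T) (hS : IsOpen S) (L : V ≃L[ℂ] V)
    (hT : ∀ y, L y ∈ T' ↔ y ∈ T) : IsBiholomorphicOnto J (L ∘ f) S T' := by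
  obtain ⟨hTo, ⟨hsm, hhol⟩, hbij, g, hg, hinv⟩ := hf
  have hT' : T' = L.symm ⁻¹' T := by
    ext y
    rw [Set.mem_preimage, ← hT, L.apply_symm_apply]
  have hbij' : Set.BijOn L T T' :=
    ⟨fun y hy => (hT y).2 hy, L.injective.injOn, fun y hy => ⟨L.symm y, by
      rw [hT'] at hy; exact hy, L.apply_symm_apply y⟩⟩
  refine ⟨?_, ⟨?_, fun x hx X => ?_⟩, hbij'.comp hbij, g ∘ L.symm, ?_, ?_, ?_⟩
  · rw [hT']
    exact hTo.preimage L.symm.continuous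
  · exact ((L : V →L[ℂ] V).restrictScalars ℝ).contDiff.comp_contDiffOn hsm
  · have hd : HasFDerivAt f (fderiv ℝ f x) x :=
      ((hsm.contDiffAt (hS.mem_nhds hx)).differentiableAt (by simp)).hasFDerivAt
    have hc : fderiv ℝ (L ∘ f) x = ((L : V →L[ℂ] V).restrictScalars ℝ).comp (fderiv ℝ f x) :=
      (((L : V →L[ℂ] V).restrictScalars ℝ).hasFDerivAt.comp x hd).fderiv
    simp only [hc, ContinuousLinearMap.comp_apply, hhol x hx]
    simp
  · refine hg.comp ((L.symm : V →L[ℂ] V).restrictScalars ℝ).contDiff.contDiffOn fun y hy => ?_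
    rw [hT'] at hy
    exact hy
  · intro x hx
    simpa using hinv.1 hx
  · intro y hy
    rw [hT'] at hy
    have := hinv.2 hy
    simp [this]

/-- One global holomorphic chart serves around every point, so integrability needs no torsion
condition. -/
theorem IsBiholomorphicOnto.isComplexStructureOn {E V : Type*} [NormedAddCommGroup E]
    [NormedSpace ℝ E] [NormedAddCommGroup V] [NormedSpace ℝ V] [NormedSpace ℂ V]
    {J : E → E →L[ℝ] E} {f : E → V} {S : Set E} {T : Set V}
    (hf : IsBiholomorphicOnto J f S T) (hS : IsOpen S) (hJ : ContDiffOn ℝ ∞ J S)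
    (hJ2 : ∀ x ∈ S, ∀ X : E, J x (J x X) = -X) : IsComplexStructureOn V J S :=
  ⟨hJ, hJ2, fun _ hx => ⟨S, hS, hx, subset_rfl, f, T, hf⟩⟩

/-! ### Smoothness of `Ψ` and `J3` -/

namespace SpecialKahlerDomain

open CMapGroup

variable {m : ℕ} (S : SpecialKahlerDomain m)

theorem isOpen_M : IsOpen S.M := S.isOpen_Msk.prod isOpen_univ

section Smooth

variable {E : Type*} [NormedAddCommGroup E] [NormedSpace ℝ E] {s : Set E}

theorem contDiffOn_w {x : E → CMapSpace m} (hx : ContDiffOn ℝ ∞ x s) (hM : Set.MapsTo x s S.M)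
    (A : Fin (m + 1)) : ContDiffOn ℝ ∞ (fun q => S.w (x q) A) s := by
  have h2 : ContDiffOn ℝ ∞ (fun q => (x q).2) s := contDiff_snd.comp_contDiffOn hx
  have h1 : ContDiffOn ℝ ∞ (fun q => (x q).1) s := contDiff_fst.comp_contDiffOn hx
  refine (Complex.ofRealCLM.contDiff.comp_contDiffOn
    ((contDiff_b A).comp_contDiffOn h2)).sub (ContDiffOn.sum fun B _ => ?_)
  exact ((S.contDiffOn_FAB A B).comp h1 fun q hq => (hM hq).1).mul
    (Complex.ofRealCLM.contDiff.comp_contDiffOn ((contDiff_a B).comp_contDiffOn h2))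

theorem contDiffOn_Psi : ContDiffOn ℝ ∞ S.Psi S.M := by
  have hw : ∀ A, ContDiffOn ℝ ∞ (fun x => S.w x A) S.M :=
    S.contDiffOn_w contDiffOn_id (Set.mapsTo_id _)
  have h2 : ContDiffOn ℝ ∞ (fun x : CMapSpace m => x.2) S.M := contDiff_snd.contDiffOn
  refine contDiff_fst.contDiffOn.prodMk (ContDiffOn.prodMk ?_ (contDiffOn_pi.2 hw))
  refine (Complex.ofRealCLM.contDiff.comp_contDiffOn
    (contDiffOn_const.mul (contDiff_phi.comp_contDiffOn h2)).exp).sub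
    (contDiffOn_const.mul ((Complex.ofRealCLM.contDiff.comp_contDiffOn
      (contDiff_tphi.comp_contDiffOn h2)).add (ContDiffOn.sum fun A _ =>
        (Complex.ofRealCLM.contDiff.comp_contDiffOn
          ((contDiff_a A).comp_contDiffOn h2)).mul (hw A))))

theorem contDiffOn_fibreJ :
    ContDiffOn ℝ ∞ (fun x : CMapSpace m => fibreJ (S.FMat x.1) x.2) S.M := by
  rw [contDiffOn_clm_apply]
  intro X
  have h1 : Set.MapsTo (Prod.fst : CMapSpace m → _) S.M S.Msk := fun x hx => hx.1
  have hf : ContDiffOn ℝ ∞ (Prod.fst : CMapSpace m → _) S.M := contDiff_fst.contDiffOn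
  have h2 : ContDiffOn ℝ ∞ (fun x : CMapSpace m => x.2) S.M := contDiff_snd.contDiffOn
  have hphi : ContDiffOn ℝ ∞ (fun x : CMapSpace m => x.2.phi) S.M :=
    contDiff_phi.comp_contDiffOn h2
  have ha : ∀ A, ContDiffOn ℝ ∞ (fun x : CMapSpace m => x.2.a A) S.M := fun A =>
    (contDiff_a A).comp_contDiffOn h2
  have hb : ∀ A, ContDiffOn ℝ ∞ (fun x : CMapSpace m => x.2.b A) S.M := fun A =>
    (contDiff_b A).comp_contDiffOn h2
  have hre : ∀ A B, ContDiffOn ℝ ∞ (fun x : CMapSpace m => (S.FAB x.1 A B).re) S.M :=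
    fun A B => (S.contDiffOn_re_FAB A B).comp hf h1
  have hJa : ∀ A, ContDiffOn ℝ ∞ (fun x : CMapSpace m => fibreJa (S.FMat x.1) X A) S.M :=
    contDiffOn_matrix_mulVec (fun A B => (S.contDiffOn_N_inv A B).comp hf h1) fun B =>
      (contDiffOn_matrix_mulVec (M := fun x : CMapSpace m => (S.FMat x.1).map Complex.re) hre
        (v := fun _ => X.a) (fun _ => contDiffOn_const) B).sub
          (contDiffOn_const (c := X.b B))
  have hJb : ∀ A, ContDiffOn ℝ ∞ (fun x : CMapSpace m => fibreJb (S.FMat x.1) X A) S.M :=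
    fun A => (contDiffOn_matrix_mulVec (M := fun x : CMapSpace m => S.N x.1)
      (fun A B => (S.contDiffOn_N A B).comp hf h1) (v := fun _ => X.a)
      (fun _ => contDiffOn_const) A).add (contDiffOn_matrix_mulVec
        (M := fun x : CMapSpace m => (S.FMat x.1).map Complex.re) hre hJa A)
  refine contDiffOn_mk ?_ ?_ hJa hJb
  · exact (contDiffOn_const.mul (contDiffOn_const.mul hphi).exp).mul
      (contDiffOn_const.add (ContDiffOn.sum fun A _ =>
        ((hb A).mul contDiffOn_const).sub ((ha A).mul contDiffOn_const)))
  · exact ((contDiffOn_const.mul (contDiffOn_const.mul hphi).exp).mul contDiffOn_const).sub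
      (ContDiffOn.sum fun A _ => ((hb A).mul (hJa A)).sub ((ha A).mul (hJb A)))

theorem contDiffOn_J3 : ContDiffOn ℝ ∞ S.J3 S.M := by
  rw [contDiffOn_clm_apply]
  intro X
  exact contDiffOn_const.prodMk (S.contDiffOn_fibreJ.clm_apply contDiffOn_const)

end Smooth

/-! ### The inverse of `Ψ` -/

/-- The coordinates `a^A` in terms of `w_A`. -/
noncomputable def psiA (z : Fin m → ℂ) (w : Fin (m + 1) → ℂ) : Fin (m + 1) → ℝ :=
  -(S.N z)⁻¹.mulVec (fun B => (w B).im)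

/-- The function `e^{-2φ} = Re w^0 + ∑ N^{AB} Im w_A Im w_B`. -/
noncomputable def height (z : Fin m → ℂ) (q : ℂ × (Fin (m + 1) → ℂ)) : ℝ :=
  q.1.re - ∑ A, S.psiA z q.2 A * (q.2 A).im

/-- The inverse of `(w^0, w_A)` on the fibre over `z`. -/
noncomputable def fibreInv (z : Fin m → ℂ) (q : ℂ × (Fin (m + 1) → ℂ)) : CMapGroup (m + 1) :=
  CMapGroup.mk (-(1 / 2) * Real.log (S.height z q)) (-q.1.im - ∑ A, S.psiA z q.2 A * (q.2 A).re)
    (S.psiA z q.2)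
    ((fun A => (q.2 A).re) + ((S.FMat z).map Complex.re).mulVec (S.psiA z q.2))

/-- The image of `Ψ`. -/
def PsiImage : Set ((Fin m → ℂ) × (ℂ × (Fin (m + 1) → ℂ))) :=
  {p | p.1 ∈ S.Msk ∧ 0 < S.height p.1 p.2}

/-- Because `a` and `b` are real, `Im w = -N a`, which can be inverted. -/
theorem psiA_w {x : CMapSpace m} (hx : x ∈ S.M) : S.psiA x.1 (S.w x) = x.2.a := by
  have h : (fun A => (S.w x A).im) = -(S.N x.1).mulVec x.2.a := beta_im (S.FMat x.1) x.2
  rw [psiA, h, Matrix.mulVec_neg, neg_neg, Matrix.mulVec_mulVec,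
    Matrix.nonsing_inv_mul _ (S.isUnit_det_N hx.1), Matrix.one_mulVec]

/-- `Re w^0 = e^{-2φ} + ∑ a^A Im w_A`, and `a` is already known from `w`. Positivity of the
exponential is thus the only constraint on the image of a fibre. -/
theorem height_Psi {x : CMapSpace m} (hx : x ∈ S.M) :
    S.height x.1 (S.Psi x).2 = Real.exp (-2 * x.2.phi) := by
  simp only [height, Psi, S.psiA_w hx, w0]
  simp [-Complex.ofReal_exp]

theorem fibreInv_Psi {x : CMapSpace m} (hx : x ∈ S.M) : S.fibreInv x.1 (S.Psi x).2 = x.2 := by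
  have h : (fun A => (S.w x A).re) = x.2.b - ((S.FMat x.1).map Complex.re).mulVec x.2.a :=
    beta_re (S.FMat x.1) x.2
  refine coord_ext ?_ ?_ (fun A => ?_) fun A => ?_
  · rw [fibreInv, phi_mk, S.height_Psi hx, Real.log_exp]; ring
  · simp only [fibreInv, tphi_mk, Psi, S.psiA_w hx, w0]
    simp [-Complex.ofReal_exp]
  · simp only [fibreInv, a_mk, Psi, S.psiA_w hx]
  · simp only [fibreInv, b_mk, Psi, S.psiA_w hx, h]
    simp

theorem w_fibreInv {z : Fin m → ℂ} (hz : z ∈ S.Msk) (q : ℂ × (Fin (m + 1) → ℂ)) :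
    S.w (z, S.fibreInv z q) = q.2 := by
  have h1 : (fun A => (S.w (z, S.fibreInv z q) A).im) = _ := beta_im (S.FMat z) (S.fibreInv z q)
  have h2 : (fun A => (S.w (z, S.fibreInv z q) A).re) = _ := beta_re (S.FMat z) (S.fibreInv z q)
  simp only [fibreInv, a_mk, FMat_map_im, psiA, Matrix.mulVec_neg, Matrix.mulVec_mulVec,
    Matrix.mul_nonsing_inv _ (S.isUnit_det_N hz), Matrix.one_mulVec, neg_neg] at h1
  simp only [fibreInv, a_mk, b_mk, add_sub_cancel_right] at h2
  ext A
  exact Complex.ext (congrFun h2 A) (congrFun h1 A)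

theorem Psi_fibreInv {z : Fin m → ℂ} (hz : z ∈ S.Msk) {q : ℂ × (Fin (m + 1) → ℂ)}
    (hq : 0 < S.height z q) : S.Psi (z, S.fibreInv z q) = (z, q) := by
  have hexp : Real.exp (-2 * (S.fibreInv z q).phi) = S.height z q := by
    rw [fibreInv, phi_mk, ← mul_assoc]
    norm_num [Real.exp_log hq]
  refine Prod.ext rfl (Prod.ext ?_ (S.w_fibreInv hz q))
  simp only [Psi, w0, S.w_fibreInv hz, hexp]
  refine Complex.ext ?_ ?_
  · simp [height, fibreInv]
  · simp [fibreInv]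

theorem contDiffOn_psiA (A : Fin (m + 1)) : ContDiffOn ℝ ∞
    (fun p : (Fin m → ℂ) × (ℂ × (Fin (m + 1) → ℂ)) => S.psiA p.1 p.2.2 A)
    (S.Msk ×ˢ Set.univ) := by
  have hN : ∀ A B, ContDiffOn ℝ ∞
      (fun p : (Fin m → ℂ) × (ℂ × (Fin (m + 1) → ℂ)) => (S.N p.1)⁻¹ A B)
      (S.Msk ×ˢ Set.univ) := fun A B =>
    (S.contDiffOn_N_inv A B).comp contDiff_fst.contDiffOn fun p hp => hp.1
  exact (contDiffOn_matrix_mulVec hN (fun B => (Complex.imCLM.contDiff.comp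
    ((contDiff_apply ℝ ℂ B).comp (contDiff_snd.comp contDiff_snd))).contDiffOn) A).neg

theorem contDiffOn_height : ContDiffOn ℝ ∞
    (fun p : (Fin m → ℂ) × (ℂ × (Fin (m + 1) → ℂ)) => S.height p.1 p.2) (S.Msk ×ˢ Set.univ) := by
  refine (Complex.reCLM.contDiff.comp (contDiff_fst.comp contDiff_snd)).contDiffOn.sub
    (ContDiffOn.sum fun A _ => (S.contDiffOn_psiA A).mul ?_)
  exact (Complex.imCLM.contDiff.comp ((contDiff_apply ℝ ℂ A).comp
    (contDiff_snd.comp contDiff_snd))).contDiffOn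

theorem isOpen_PsiImage : IsOpen S.PsiImage := by
  have h := S.contDiffOn_height.continuousOn.isOpen_inter_preimage
    (S.isOpen_Msk.prod isOpen_univ) (isOpen_Ioi (a := 0))
  refine (congrArg IsOpen (Set.ext fun p => ?_)).mp h
  exact ⟨fun hp => ⟨hp.1.1, hp.2⟩, fun hp => ⟨⟨hp.1, Set.mem_univ _⟩, hp.2⟩⟩

theorem contDiffOn_fibreInv :
    ContDiffOn ℝ ∞ (fun p : (Fin m → ℂ) × (ℂ × (Fin (m + 1) → ℂ)) => S.fibreInv p.1 p.2)
      S.PsiImage := by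
  have hsub : S.PsiImage ⊆ S.Msk ×ˢ Set.univ := fun p hp => ⟨hp.1, Set.mem_univ _⟩
  have hA := fun A => (S.contDiffOn_psiA A).mono hsub
  have hre : ∀ A, ContDiffOn ℝ ∞
      (fun p : (Fin m → ℂ) × (ℂ × (Fin (m + 1) → ℂ)) => (p.2.2 A).re) S.PsiImage := fun A =>
    (Complex.reCLM.contDiff.comp ((contDiff_apply ℝ ℂ A).comp
      (contDiff_snd.comp contDiff_snd))).contDiffOn
  refine contDiffOn_mk ?_ ?_ hA fun A => ?_
  · exact contDiffOn_const.mul ((S.contDiffOn_height.mono hsub).log fun p hp => hp.2.ne')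
  · exact (Complex.imCLM.contDiff.comp (contDiff_fst.comp contDiff_snd)).contDiffOn.neg.sub
      (ContDiffOn.sum fun A _ => (hA A).mul (hre A))
  · exact (hre A).add (contDiffOn_matrix_mulVec
      (M := fun p : (Fin m → ℂ) × (ℂ × (Fin (m + 1) → ℂ)) => (S.FMat p.1).map Complex.re)
      (fun A B => (S.contDiffOn_re_FAB A B).comp contDiff_fst.contDiffOn fun p hp => hp.1) hA A)

theorem mapsTo_invOn_Psi : Set.MapsTo S.Psi S.M S.PsiImage ∧
    Set.MapsTo (fun p => (p.1, S.fibreInv p.1 p.2)) S.PsiImage S.M ∧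
    Set.InvOn (fun p => (p.1, S.fibreInv p.1 p.2)) S.Psi S.M S.PsiImage := by
  refine ⟨fun x hx => ⟨hx.1, ?_⟩, fun p hp => ⟨hp.1, Set.mem_univ _⟩, fun x hx => ?_,
    fun p hp => S.Psi_fibreInv hp.1 hp.2⟩
  · have := S.height_Psi hx
    simp only [Psi] at this ⊢
    rw [this]
    exact Real.exp_pos _
  · exact Prod.ext rfl (S.fibreInv_Psi hx)

theorem isBiholomorphicOnto_Psi : IsBiholomorphicOnto S.J3 S.Psi S.M S.PsiImage := by
  obtain ⟨h1, h2, h3⟩ := S.mapsTo_invOn_Psi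
  refine ⟨S.isOpen_PsiImage, ⟨S.contDiffOn_Psi, fun x hx X => ?_⟩, h3.bijOn h1 h2, _,
    contDiff_fst.contDiffOn.prodMk S.contDiffOn_fibreInv, h3⟩
  obtain ⟨L, hL, hJ⟩ := S.exists_hasFDerivAt_Psi hx
  rw [hL.fderiv]
  exact hJ X

theorem image_Psi : S.Psi '' S.M = S.PsiImage := S.isBiholomorphicOnto_Psi.2.2.1.image_eq

/-! ### The fibres and their normal form -/

/-- Restriction of `Ψ` to a slice: on vertical vectors `(0, X)` the structure `J3` reduces to
`fibreJ`, and the inverse of `Ψ` preserves the slice. -/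
theorem isBiholomorphicOnto_fibre {p : Fin m → ℂ} (hp : p ∈ S.Msk) :
    IsBiholomorphicOnto (fibreJ (S.FMat p)) (fun g => (S.Psi (p, g)).2) Set.univ
      {q | 0 < S.height p q} := by
  have hM : ∀ g, (p, g) ∈ S.M := fun g => ⟨hp, Set.mem_univ _⟩
  have hset : {q | 0 < S.height p q} = (fun q => (p, q)) ⁻¹' S.PsiImage :=
    Set.ext fun q => (and_iff_right hp).symm
  have hinv : Set.InvOn (S.fibreInv p) (fun g => (S.Psi (p, g)).2) Set.univ
      {q | 0 < S.height p q} :=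
    ⟨fun g _ => S.fibreInv_Psi (hM g), fun q hq => congrArg Prod.snd (S.Psi_fibreInv hp hq)⟩
  refine ⟨?_, ⟨?_, fun g _ X => ?_⟩, hinv.bijOn (fun g _ => ?_) fun _ _ => Set.mem_univ _,
    S.fibreInv p, ?_, hinv⟩
  · rw [hset]
    exact S.isOpen_PsiImage.preimage (by fun_prop)
  · exact contDiff_snd.comp_contDiffOn (S.contDiffOn_Psi.comp
      (contDiff_const.prodMk contDiff_id).contDiffOn fun g _ => hM g)
  · obtain ⟨L, hL, hJ⟩ := S.exists_hasFDerivAt_Psi (hM g)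
    have hd : HasFDerivAt (fun g => (S.Psi (p, g)).2) _ g :=
      (hasFDerivAt_snd (p := S.Psi (p, g))).comp g (hL.comp g (hasFDerivAt_prodMk_right p g))
    rw [hd.fderiv]
    have := congrArg Prod.snd (hJ (0, X))
    rw [J3_apply, smul_zero] at this
    exact this
  · exact (Real.exp_pos _).trans_eq (S.height_Psi (hM g)).symm
  · rw [hset]
    exact S.contDiffOn_fibreInv.comp (contDiff_const.prodMk contDiff_id).contDiffOn
      fun q hq => hq

/-- With `y = Im w` the height is `Re w^0 + yᵀ N⁻¹ y`, and `N⁻¹ = P D Pᵀ` for `D = diag(-1, …, -1,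
1)`. As `P` is real, `Pᵀ y` is the imaginary part of `Pᵀ w`. -/
theorem height_eq_of_signature {z : Fin m → ℂ} {P : Matrix (Fin (m + 1)) (Fin (m + 1)) ℝ}
    (hP : P.transpose * S.N z * P =
      Matrix.diagonal (fun A => if A = Fin.last m then 1 else -1))
    (q : ℂ × (Fin (m + 1) → ℂ)) :
    S.height z q = q.1.re - ((∑ A : Fin m,
      ((P.map (algebraMap ℝ ℂ)).transpose.mulVec q.2 A.castSucc).im ^ 2)
      - ((P.map (algebraMap ℝ ℂ)).transpose.mulVec q.2 (Fin.last m)).im ^ 2) := by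
  set y : Fin (m + 1) → ℝ := fun A => (q.2 A).im with hy
  have him : ∀ A, ((P.map (algebraMap ℝ ℂ)).transpose.mulVec q.2 A).im =
      P.transpose.mulVec y A := by
    intro A; simp [Matrix.mulVec, dotProduct, hy]
  have hsum : ∑ A, S.psiA z q.2 A * (q.2 A).im =
      -(y ⬝ᵥ (S.N z)⁻¹.mulVec y) := by
    simp [psiA, dotProduct, hy, mul_comm]
  rw [height, hsum, Matrix.inv_eq_right_inv (mul_signature_eq_one hP)]
  simp only [him]
  rw [← Matrix.mulVec_mulVec, ← Matrix.mulVec_mulVec, Matrix.dotProduct_mulVec,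
    ← Matrix.mulVec_transpose, dotProduct, Fin.sum_univ_castSucc]
  simp [Matrix.mulVec_diagonal, (Fin.castSucc_lt_last _).ne, Finset.sum_neg_distrib, pow_two]
  ring

theorem exists_isBiholomorphicOnto_fibreDomain {p : Fin m → ℂ} (hp : p ∈ S.Msk) :
    ∃ f : CMapGroup (m + 1) → ℂ × (Fin (m + 1) → ℂ),
      IsBiholomorphicOnto (fibreJ (S.FMat p)) f Set.univ (fibreDomain m) := by
  obtain ⟨P, hPu, hP⟩ := S.signature _ hp
  set Q : Matrix (Fin (m + 1)) (Fin (m + 1)) ℂ := (P.map (algebraMap ℝ ℂ)).transpose with hQ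
  have hQu : IsUnit Q.det := by
    rw [hQ, Matrix.det_transpose, ← RingHom.mapMatrix_apply, ← RingHom.map_det]
    exact hPu.map _
  -- The real matrix `Pᵀ` is extended complex-linearly to the `w_A`, so that composing with `L`
  -- preserves holomorphy; `w^0` is left fixed.
  let L : (ℂ × (Fin (m + 1) → ℂ)) ≃L[ℂ] (ℂ × (Fin (m + 1) → ℂ)) :=
    (ContinuousLinearEquiv.refl ℂ ℂ).prodCongr
      (Matrix.toLin'OfInv (Matrix.nonsing_inv_mul Q hQu)
        (Matrix.mul_nonsing_inv Q hQu)).toContinuousLinearEquiv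
  have hL : ∀ q, L q = (q.1, Q.mulVec q.2) := fun q => rfl
  refine ⟨_, (S.isBiholomorphicOnto_fibre hp).comp_equiv isOpen_univ L fun q => ?_⟩
  rw [Set.mem_ofPred_eq, S.height_eq_of_signature hP, sub_pos, hL]
  rfl

end SpecialKahlerDomain

/-! ### Assembly of the proposition -/

theorem mainTheorem4 (m : ℕ) (S : SpecialKahlerDomain m)
    (e : (Fin m → ℂ) → Matrix (Fin m) (Fin m) ℂ) (he : S.IsVielbein e) :
    ∃ J3 : CMapSpace m → CMapSpace m →L[ℝ] CMapSpace m,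
      -- the vielbein determines a unique `J_3`, which is a complex structure on `M`
      S.IsCMapJ e 2 J3 ∧
      (∀ J' : CMapSpace m → CMapSpace m →L[ℝ] CMapSpace m, S.IsCMapJ e 2 J' →
        ∀ x ∈ S.M, J' x = J3 x) ∧
      IsComplexStructureOn ((Fin m → ℂ) × (ℂ × (Fin (m + 1) → ℂ))) J3 S.M ∧
      (∃ JG : (Fin m → ℂ) → CMapGroup (m + 1) → CMapGroup (m + 1) →L[ℝ] CMapGroup (m + 1),
        -- `J_3 = J + J_G` with a smooth family of left-invariant complex structures on `G`
        (∀ x ∈ S.M, ∀ X : CMapSpace m, J3 x X = (Complex.I • X.1, JG x.1 x.2 X.2)) ∧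
        ContDiffOn ℝ ∞ (fun x : CMapSpace m => JG x.1 x.2) S.M ∧
        (∀ p ∈ S.Msk,
          IsComplexStructureOn (ℂ × (Fin (m + 1) → ℂ)) (JG p) Set.univ ∧
          CMapGroup.IsLeftInvariant (JG p)) ∧
        -- the fibres are biholomorphic to `F(n+1)`
        (∀ p ∈ S.Msk, ∃ f : CMapGroup (m + 1) → ℂ × (Fin (m + 1) → ℂ),
          IsBiholomorphicOnto (JG p) f Set.univ (fibreDomain m))) ∧
      -- the projection `M → M_sk` is a holomorphic submersion onto `M_sk`
      Prod.fst '' S.M = S.Msk ∧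
      IsHolomorphicOn J3 (Prod.fst : CMapSpace m → (Fin m → ℂ)) S.M ∧
      (∀ x ∈ S.M, Function.Surjective
        (fderiv ℝ (Prod.fst : CMapSpace m → (Fin m → ℂ)) x)) ∧
      -- `Ψ = (π, w^0, w_A)` is a fibre-preserving open holomorphic embedding
      (∀ x ∈ S.M, (S.Psi x).1 = x.1) ∧
      IsBiholomorphicOnto J3 S.Psi S.M (S.Psi '' S.M) := by
  have hsq : ∀ x ∈ S.M, ∀ X, S.J3 x (S.J3 x X) = -X := fun x hx X => by
    simp only [SpecialKahlerDomain.J3_apply]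
    rw [CMapGroup.fibreJ_fibreJ (F := S.FMat x.1) (S.isUnit_det_N hx.1), smul_smul,
      Complex.I_mul_I, neg_one_smul]
    rfl
  refine ⟨S.J3, S.isCMapJ_J3 e, fun J' hJ x hx => S.eq_J3_of_isCMapJ he hJ hx,
    S.isBiholomorphicOnto_Psi.isComplexStructureOn S.isOpen_M S.contDiffOn_J3 hsq,
    ⟨fun z => CMapGroup.fibreJ (S.FMat z), fun x _ X => S.J3_apply x X, S.contDiffOn_fibreJ,
      fun p hp => ⟨?_, CMapGroup.isLeftInvariant_fibreJ (F := S.FMat p) (S.isUnit_det_N hp)⟩,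
      fun p hp => S.exists_isBiholomorphicOnto_fibreDomain hp⟩,
    ?_, ⟨contDiff_fst.contDiffOn, fun x _ X => ?_⟩, fun x _ => ?_, fun _ _ => rfl, ?_⟩
  · refine (S.isBiholomorphicOnto_fibre hp).isComplexStructureOn isOpen_univ ?_
      fun g _ X => CMapGroup.fibreJ_fibreJ (F := S.FMat p) (S.isUnit_det_N hp) g X
    exact S.contDiffOn_fibreJ.comp (contDiff_const.prodMk contDiff_id).contDiffOn
      fun g _ => ⟨hp, Set.mem_univ _⟩
  · exact Set.fst_image_prod _ Set.univ_nonempty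
  · rw [fderiv_fst]
    rfl
  · rw [fderiv_fst]
    exact Prod.fst_surjective
  · rw [S.image_Psi]
    exact S.isBiholomorphicOnto_Psi
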